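/- Let $G=\mathrm{GL}_3(\mathbb F_2)$. Let $V_1$ be the set of points of the Fano plane, i.e. the set of non-zero row vectors of length 3 over $\mathbb F_2$, on which $G$ acts on the right by $v\mapsto vg$. Let $V_2$ be the set of lines of the Fano plane, i.e. of the subsets of $V_1$ of the form $\{v\in V_1 : \langle v,w\rangle=0\}$ with $w\in\mathbb F_2^3$ non-zero, with the right action of $G$ induced from that on the points. Put $$A=\begin{pmatrix}1&1&0\\0&0&1\\0&1&0\end{pmatrix},\qquad B=\begin{pmatrix}0&1&0\\0&0&1\\1&0&0\end{pmatrix}\in G .$$ For $i=1,2$ let $V_i[A,B]$ be the Schreier graph with vertex set $V_i$ and with one edge from $v$ to $vs$ for every pair $(v,s)\in V_i\times\{A,B\}$ (self-edges and multiple edges are allowed). For real numbers $l_A,l_B>0$ let $X_i$ be the geometric realization of $V_i[A,B]$ in which every edge $(v,A)$ has length $l_A$ and every edge $(v,B)$ has length $l_B$, with the length metric (the distance of two points is the infimum of the lengths of the paths between them). For a connected compact semi-locally simply connected length space $X$ with base point $x_0$ and $\delta>0$ let $\mathrm{Fil}^\delta\pi_1(X,x_0)$ be the subgroup of $\pi_1(X,x_0)$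 generated by the classes $[\alpha*\beta*\bar\alpha]$, where $\beta$ is a loop contained in some open ball of radius $\delta$ in $X$, $\alpha$ is a path from $x_0$ to $\beta(0)$, and $\bar\alpha$ is its reverse. The covering spectrum of $X$ is $$\mathrm{CovSpec}(X)=\{\delta>0 : \mathrm{Fil}^\delta\pi_1(X,x_0)\neq \mathrm{Fil}^{\varepsilon}\pi_1(X,x_0)\text{ for all }\varepsilon>\delta\};$$ it does not depend on $x_0$. If $0<l_A<l_B<\tfrac32 l_A$, then $l_A+\tfrac12 l_B\in\mathrm{CovSpec}(X_1)$ and $l_A+\tfrac12 l_B\notin\mathrm{CovSpec}(X_2)$. -/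

import Mathlib

/-! ### Filtrations of groups and the covering spectrum -/

/-- The jump set of a filtration `F` of a group `G`, i.e. of a family of subgroups of `G` that is
indexed by an ordered set `I` and increasing in the index. -/
def jumpSet {I G : Type*} [Preorder I] [Group G] (F : I →o Subgroup G) : Set I :=
  {i | ∀ j, i < j → F i ≠ F j}

/-- The classes `[α * β * ᾱ]` in `π₁(X, x₀)`, where `β` is a loop contained in some open `δ`-ball
of `X` and `α` is a path from `x₀` to the base point of `β`. -/
def smallLoopClasses {X : Type*} [PseudoEMetricSpace X] (x₀ : X) (δ : ℝ) :
    Set (FundamentalGroup X x₀) :=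
  {g | ∃ (y : X) (α : Path x₀ y) (β : Path y y),
    (∃ c : X, ∀ s, edist (β s) c < ENNReal.ofReal δ) ∧
      g = FundamentalGroup.fromPath
        (Path.Homotopic.Quotient.mk ((α.trans β).trans α.symm))}

/-- The filtration of `π₁(X, x₀)`, indexed by the positive reals, whose `δ`-th step is generated by
the classes `[α * β * ᾱ]` of loops `β` contained in an open `δ`-ball. -/
noncomputable def ballFiltration {X : Type*} [PseudoEMetricSpace X] (x₀ : X) :
    Set.Ioi (0 : ℝ) →o Subgroup (FundamentalGroup X x₀) where
  toFun δ := Subgroup.closure (smallLoopClasses x₀ (δ : ℝ))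
  monotone' := by
    intro δ ε h
    apply Subgroup.closure_mono
    rintro g ⟨y, α, β, ⟨c, hc⟩, hg⟩
    exact ⟨y, α, β, ⟨c, fun s => (hc s).trans_le (ENNReal.ofReal_le_ofReal h)⟩, hg⟩

/-- The covering spectrum of a connected space `X`, computed at the base point `x₀`: the set of
jumps of the filtration of `π₁(X, x₀)` by loops in `δ`-balls. -/
def covSpec (X : Type*) [PseudoEMetricSpace X] (x₀ : X) : Set ℝ :=
  Subtype.val '' jumpSet (ballFiltration x₀)

/-! ### Graphs and their geometric realizations -/

/-- A directed graph with vertex set `V` and edge set `E`, possibly with self-edges and multiple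
edges; each edge has an origin and a target. -/
structure DirGraph (V E : Type*) where
  o : E → V
  t : E → V

namespace DirGraph

variable {V E : Type*}

/-- The gluing of one interval `[0,1]` for each edge `e` onto the set of vertices: `0` is
identified with the origin of `e` and `1` with its target. -/
inductive Glue (Γ : DirGraph V E) : V ⊕ E × unitInterval → V ⊕ E × unitInterval → Prop
  | origin (e : E) : Glue Γ (Sum.inr (e, 0)) (Sum.inl (Γ.o e))
  | target (e : E) : Glue Γ (Sum.inr (e, 1)) (Sum.inl (Γ.t e))

/-- The geometric realization of a graph whose edges `e` have lengths `l e > 0`. (As a set it does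
not depend on `l`; the metric defined below does.) -/
def Realization (Γ : DirGraph V E) (_l : E → ℝ) : Type _ :=
  Quot Γ.Glue

namespace Realization

variable {Γ : DirGraph V E} {l : E → ℝ}

/-- The point with parameter `s` on the edge `e`. -/
def pt (e : E) (s : unitInterval) : Γ.Realization l :=
  Quot.mk _ (Sum.inr (e, s))

/-- `Chain x y r` holds if there is a path of length `r` from `x` to `y` that is a concatenation of
finitely many segments, each of them inside one edge. The segment of the edge `e` between the
parameters `s` and `s'` has length `l e * |s - s'|`. -/
inductive Chain : Γ.Realization l → Γ.Realization l → ℝ → Prop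
  | nil (x : Γ.Realization l) : Chain x x 0
  | cons (e : E) (s s' : unitInterval) {y : Γ.Realization l} {r : ℝ} :
      Chain (pt e s') y r → Chain (pt e s) y (l e * |(s : ℝ) - s'| + r)

theorem Chain.append {x y z : Γ.Realization l} {r r' : ℝ} (h : Chain x y r) (h' : Chain y z r') :
    Chain x z (r + r') := by
  induction h with
  | nil x => simpa using h'
  | cons e s s' _ ih => rw [add_assoc]; exact Chain.cons e s s' (ih h')

theorem Chain.symm {x y : Γ.Realization l} {r : ℝ} (h : Chain x y r) : Chain y x r := by
  induction h with
  | nil x => exact Chain.nil x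
  | cons e s s' _ ih =>
    have h2 : Chain (Γ := Γ) (l := l) (pt e s') (pt e s) (l e * |(s' : ℝ) - s| + 0) :=
      Chain.cons e s' s (Chain.nil _)
    have h3 := ih.append h2
    rwa [add_zero, abs_sub_comm, add_comm] at h3

/-- The length metric of the realization: the distance of two points is the infimum of the lengths
of the paths between them (and infinite if there is none, which happens only for points in
different components of the graph). The topology is that of this metric. -/
noncomputable instance : PseudoEMetricSpace (Γ.Realization l) where
  edist x y := ⨅ (r : ℝ) (_ : Chain x y r), ENNReal.ofReal r
  edist_self x := le_antisymm
    ((iInf₂_le (0 : ℝ) (Chain.nil x)).trans_eq ENNReal.ofReal_zero) bot_le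
  edist_comm x y := le_antisymm
    (le_iInf₂ fun r h => iInf₂_le r h.symm) (le_iInf₂ fun r h => iInf₂_le r h.symm)
  edist_triangle x y z := by
    simp only [ENNReal.iInf_add, ENNReal.add_iInf]
    refine le_iInf₂ fun r h => le_iInf₂ fun r' h' => ?_
    refine (iInf₂_le (r' + r) (h'.append h)).trans ENNReal.ofReal_add_le

end Realization

end DirGraph

/-- The generalized Cayley graph (Schreier graph) `V[S]` of a set `V` with a right action of a group
`G` and of a subset `S` of `G`: the edges are the pairs `(v, s)`, with origin `v` and target `vs`.
A right action of `G` is an action of the opposite group. -/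
def cayleyGraph {G : Type*} [Group G] (V : Type*) [MulAction Gᵐᵒᵖ V] (S : Set G) :
    DirGraph V (V × S) where
  o e := e.1
  t e := MulOpposite.op (e.2 : G) • e.1

/-! ### The Fano plane -/

/-- The group `GL₃(𝔽₂)`. -/
abbrev GL3F2 : Type := GL (Fin 3) (ZMod 2)

/-- The points of the Fano plane: non-zero row vectors of length 3 over `𝔽₂`. -/
abbrev FanoPoint : Type := {v : Fin 3 → ZMod 2 // v ≠ 0}

/-- A set of points of the Fano plane is a line if it is the set of points that are orthogonal to
some non-zero vector. -/
def IsFanoLine (L : Finset FanoPoint) : Prop :=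
  ∃ w : Fin 3 → ZMod 2, w ≠ 0 ∧ ∀ p : FanoPoint, p ∈ L ↔ p.1 ⬝ᵥ w = 0

/-- The lines of the Fano plane. -/
abbrev FanoLine : Type := {L : Finset FanoPoint // IsFanoLine L}

theorem vecMul_ne_zero (g : GL3F2) {v : Fin 3 → ZMod 2} (hv : v ≠ 0) :
    Matrix.vecMul v g.val ≠ 0 := fun h => hv (by
  have h2 : Matrix.vecMul (Matrix.vecMul v g.val) g⁻¹.val = v := by
    rw [Matrix.vecMul_vecMul, Units.mul_inv, Matrix.vecMul_one]
  rw [← h2, h, Matrix.zero_vecMul])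

/-- `GL₃(𝔽₂)` acts on the right on points by multiplication of row vectors with matrices. -/
instance : MulAction GL3F2ᵐᵒᵖ FanoPoint where
  smul g v := ⟨Matrix.vecMul v.1 g.unop.val, vecMul_ne_zero g.unop v.2⟩
  one_smul v := Subtype.ext (Matrix.vecMul_one v.1)
  mul_smul g h v := Subtype.ext (Matrix.vecMul_vecMul v.1 h.unop.val g.unop.val).symm

theorem FanoPoint.coe_smul (g : GL3F2ᵐᵒᵖ) (v : FanoPoint) :
    (g • v).1 = Matrix.vecMul v.1 g.unop.val := rfl

theorem IsFanoLine.image_smul (g : GL3F2ᵐᵒᵖ) {L : Finset FanoPoint} (hL : IsFanoLine L) :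
    IsFanoLine (L.image fun p => g • p) := by
  obtain ⟨w, hw, h⟩ := hL
  refine ⟨Matrix.mulVec (g.unop⁻¹).val w, ?_, ?_⟩
  · intro h0
    apply hw
    have h2 : Matrix.mulVec g.unop.val (Matrix.mulVec (g.unop⁻¹).val w) = w := by
      rw [Matrix.mulVec_mulVec, Units.mul_inv, Matrix.one_mulVec]
    rw [← h2, h0, Matrix.mulVec_zero]
  · intro p
    rw [Matrix.dotProduct_mulVec]
    have key : Matrix.vecMul p.1 (g.unop⁻¹).val
        = (g⁻¹ • p).1 := rfl
    rw [key, ← h, Finset.mem_image]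
    constructor
    · rintro ⟨q, hq, rfl⟩
      rwa [inv_smul_smul]
    · intro hp
      exact ⟨_, hp, smul_inv_smul g p⟩

/-- `GL₃(𝔽₂)` acts on the right on lines: `g` maps a line to the set of images of its points. -/
instance : MulAction GL3F2ᵐᵒᵖ FanoLine where
  smul g L := ⟨L.1.image fun p => g • p, L.2.image_smul g⟩
  one_smul L := Subtype.ext (by
    change L.1.image (fun p => (1 : GL3F2ᵐᵒᵖ) • p) = L.1
    simp)
  mul_smul g h L := Subtype.ext (by
    change L.1.image (fun p => (g * h) • p) = (L.1.image fun p => h • p).image fun p => g • p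
    simp only [Finset.image_image, Function.comp_def, mul_smul])

/-- The matrix `A`, with its inverse. -/
def fanoA : GL3F2 where
  val := !![1, 1, 0; 0, 0, 1; 0, 1, 0]
  inv := !![1, 0, 1; 0, 0, 1; 0, 1, 0]
  val_inv := by decide
  inv_val := by decide

/-- The matrix `B`, with its inverse. -/
def fanoB : GL3F2 where
  val := !![0, 1, 0; 0, 0, 1; 1, 0, 0]
  inv := !![0, 0, 1; 1, 0, 0; 0, 1, 0]
  val_inv := by decide
  inv_val := by decide

/-- The lengths of the edges of a graph `V[A, B]`: `lA` for edges of type `A` and `lB` for edges of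
type `B`. -/
def fanoLength {V : Type} (lA lB : ℝ) (e : V × ({fanoA, fanoB} : Set GL3F2)) : ℝ :=
  if (e.2 : GL3F2) = fanoA then lA else lB

/-- The length space of the graph `V[A, B]` whose edges of type `A` have length `lA` and whose edges
of type `B` have length `lB`. -/
abbrev FanoSpace (V : Type) [MulAction GL3F2ᵐᵒᵖ V] (lA lB : ℝ) : Type :=
  (cayleyGraph V ({fanoA, fanoB} : Set GL3F2)).Realization (fanoLength lA lB)

/-!
# The covering spectra of two length graphs of the Fano plane

The number `l_A + l_B / 2` is half of `2 l_A + l_B`, the length of a triangle with two edges `A` and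
one edge `B`. The graph of points contains such a triangle, through `(1, 1, 0)`, `(1, 1, 1)` and
`(1, 0, 1)`; the graph of lines does not.

The bridge between the filtration by balls and the combinatorics of the graph is
`mem_of_loop_in_ball`: a family of loop classes (`NormalLoops`) that is closed under products and
conjugation by paths, and contains all closed walks of the graph of length less than `2ε`, contains
every loop in an open ball of radius `ε`. Indeed, such a loop can be subdivided into small pieces,
each of which is homotopic to a short chain of segments (`exists_nhds_shortChain`). Joining the
points of subdivision to the centre of the ball by chains shorter than `ε` writes the loop as a
product of conjugates of closed chains shorter than `2ε`, and a closed chain is freely homotopic to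
a closed walk that is not longer (`mem_of_closed_chainClass`). Conversely, a closed chain shorter
than `2δ` lies in the open `δ`-ball around its base point (`ChainClass.mem_ofBalls`).

For points, the edge `A` from `(1, 1, 1)` to `(1, 0, 1)` defines a map to the circle that collapses
all the other edges. All closed walks shorter than the triangle have at most two edges, or are made
of three edges `A`; a finite check shows that they pass through this edge zero times, counted with
orientation. So the loops in the step `l_A + l_B / 2` of the filtration have winding number zero in
the circle, whereas the triangle, which lies in all later steps, has winding number one.

For lines, let `2ε = min (4 l_A) (l_A + 2 l_B)`. A closed walk shorter than `2ε` is shorter than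
`2 l_A + l_B`, or it has two edges `A` and one edge `B`. In the second case it visits a vertex twice
(`exists_eq_of_isWalk`), hence it is a product of conjugates of shorter closed walks. So the
filtration does not change between `l_A + l_B / 2` and `ε`.
-/

open scoped unitInterval Topology

/-! ### The topology of the realization of a finite graph -/

namespace DirGraph

namespace Realization

section Basic

variable {V E : Type*} {Γ : DirGraph V E} {l : E → ℝ}

/-- The point of the realization given by a vertex of the graph. -/
def vert (v : V) : Γ.Realization l :=
  Quot.mk _ (Sum.inl v)

theorem pt_zero (e : E) : (pt e 0 : Γ.Realization l) = vert (Γ.o e) :=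
  Quot.sound (Glue.origin e)

theorem pt_one (e : E) : (pt e 1 : Γ.Realization l) = vert (Γ.t e) :=
  Quot.sound (Glue.target e)

/-- The map out of the realization given by compatible maps on the edges and on the vertices. -/
def lift {Y : Type*} (F : E → I → Y) (G : V → Y) (h₀ : ∀ e, F e 0 = G (Γ.o e))
    (h₁ : ∀ e, F e 1 = G (Γ.t e)) : Γ.Realization l → Y :=
  Quot.lift (Sum.elim G fun p => F p.1 p.2) (by
    rintro _ _ (e | e)
    · exact h₀ e
    · exact h₁ e)

section lift

variable {Y : Type*} (F : E → I → Y) (G : V → Y) (h₀ : ∀ e, F e 0 = G (Γ.o e))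
  (h₁ : ∀ e, F e 1 = G (Γ.t e))

@[simp]
theorem lift_pt (e : E) (s : I) :
    lift (l := l) F G h₀ h₁ (pt e s) = F e s := rfl

@[simp]
theorem lift_vert (v : V) : lift (l := l) F G h₀ h₁ (vert v) = G v := rfl

end lift

open Classical in
/-- The unique representative of a point of the realization that is either a vertex or lies in the
interior of an edge. -/
noncomputable def normalForm : Γ.Realization l → V ⊕ E × I :=
  lift (fun e s => if s = 0 then Sum.inl (Γ.o e) else if s = 1 then Sum.inl (Γ.t e)
    else Sum.inr (e, s)) Sum.inl (by simp) (by simp)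

theorem vert_injective : Function.Injective (vert : V → Γ.Realization l) := fun v w h => by
  have := congrArg normalForm h
  simpa [normalForm] using this

theorem pt_eq_vert_iff {e : E} {s : I} {v : V} :
    (pt e s : Γ.Realization l) = vert v ↔ (s = 0 ∧ Γ.o e = v) ∨ (s = 1 ∧ Γ.t e = v) := by
  constructor
  · intro h
    have h' := congrArg normalForm h
    simp only [normalForm, lift_pt, lift_vert] at h'
    split_ifs at h' with h0 h1
    · exact Or.inl ⟨h0, Sum.inl_injective h'⟩
    · exact Or.inr ⟨h1, Sum.inl_injective h'⟩
  · rintro (⟨rfl, rfl⟩ | ⟨rfl, rfl⟩)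
    · exact pt_zero e
    · exact pt_one e

theorem pt_eq_pt_of_interior {e e' : E} {s s' : I} (h0 : s ≠ 0) (h1 : s ≠ 1)
    (h : (pt e' s' : Γ.Realization l) = pt e s) : e' = e ∧ s' = s := by
  have h' := congrArg normalForm h
  simp only [normalForm, lift_pt, h0, h1, if_false] at h'
  split_ifs at h'
  simpa using h'

theorem exists_pt_eq (ho : Function.Surjective Γ.o) (x : Γ.Realization l) :
    ∃ e s, x = pt e s := by
  obtain ⟨v | ⟨e, s⟩, rfl⟩ := Quot.exists_rep x
  · obtain ⟨e, rfl⟩ := ho v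
    exact ⟨e, 0, (pt_zero e).symm⟩
  · exact ⟨e, s, rfl⟩

theorem Chain.nonneg (hl : ∀ e, 0 < l e) {x y : Γ.Realization l} {r : ℝ} (h : Chain x y r) :
    0 ≤ r := by
  induction h with
  | nil x => exact le_rfl
  | cons e s s' _ ih => have := hl e; positivity

theorem Chain.edist_le {x y : Γ.Realization l} {r : ℝ} (h : Chain x y r) :
    edist x y ≤ ENNReal.ofReal r :=
  iInf₂_le r h

theorem exists_chain_of_edist_lt {x y : Γ.Realization l} {ε : ℝ}
    (h : edist x y < ENNReal.ofReal ε) : ∃ r < ε, Chain x y r := by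
  have h' : (⨅ (r : ℝ) (_ : Chain x y r), ENNReal.ofReal r) < ENNReal.ofReal ε := h
  simp only [iInf_lt_iff] at h'
  obtain ⟨r, hr, hlt⟩ := h'
  exact ⟨r, (ENNReal.ofReal_lt_ofReal_iff'.1 hlt).1, hr⟩

theorem edist_pt_le (e : E) (s s' : I) :
    edist (pt e s : Γ.Realization l) (pt e s') ≤ ENNReal.ofReal (l e * |(s : ℝ) - s'|) := by
  simpa using (Chain.cons e s s' (Chain.nil (Γ := Γ) (l := l) (pt e s'))).edist_le

theorem continuous_pt (e : E) : Continuous (pt e : I → Γ.Realization l) := by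
  rw [EMetric.continuous_iff']
  intro s ε hε
  have hc : Continuous fun s' : I => ENNReal.ofReal (l e * |(s' : ℝ) - s|) :=
    ENNReal.continuous_ofReal.comp (by fun_prop)
  have h0 : ENNReal.ofReal (l e * |(s : ℝ) - s|) < ε := by simpa using hε
  filter_upwards [hc.continuousAt.eventually_lt_const h0] with s' hs'
  exact (edist_pt_le e s' s).trans_lt hs'

/-- A real-valued function on the realization is continuous if it is Lipschitz on each edge, with
the same constant for all of them. -/
theorem continuous_of_lipschitz (hl : ∀ e, 0 < l e) {K : ℝ} {f : Γ.Realization l → ℝ}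
    (hf : ∀ e s s', |f (pt e s) - f (pt e s')| ≤ K * (l e * |(s : ℝ) - s'|)) : Continuous f := by
  have hch : ∀ {x y : Γ.Realization l} {r : ℝ}, Chain x y r → |f x - f y| ≤ K * r := by
    intro x y r h
    induction h with
    | nil x => simp
    | cons e s s' _ ih =>
      rw [mul_add]
      exact (abs_sub_le _ _ _).trans (add_le_add (hf e s s') ih)
  rw [Metric.continuous_iff']
  intro x ε hε
  have hK : 0 < |K| + 1 := by positivity
  filter_upwards [Metric.eball_mem_nhds x (ENNReal.ofReal_pos.2 (div_pos hε hK))] with y hy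
  obtain ⟨r, hr, h⟩ := exists_chain_of_edist_lt hy
  rw [Real.dist_eq]
  have hr0 := h.nonneg hl
  rw [lt_div_iff₀ hK] at hr
  have h1 : K * r ≤ |K| * r := mul_le_mul_of_nonneg_right (le_abs_self K) hr0
  have h2 := hch h
  linarith

theorem exists_pos_le_length [Finite E] (hl : ∀ e, 0 < l e) : ∃ m, 0 < m ∧ ∀ e, m ≤ l e := by
  cases isEmpty_or_nonempty E
  · exact ⟨1, one_pos, fun e => isEmptyElim e⟩
  · obtain ⟨e, he⟩ := Finite.exists_min l
    exact ⟨l e, hl e, he⟩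

/-- On a finite graph it suffices to have a Lipschitz bound with respect to the parameters of the
edges. -/
theorem continuous_lift_of_lipschitz [Finite E] (hl : ∀ e, 0 < l e) {K : ℝ} (hK : 0 ≤ K)
    {F : E → I → ℝ} {G : V → ℝ} {h₀ : ∀ e, F e 0 = G (Γ.o e)} {h₁ : ∀ e, F e 1 = G (Γ.t e)}
    (hF : ∀ e s s', |F e s - F e s'| ≤ K * |(s : ℝ) - s'|) :
    Continuous (lift (l := l) F G h₀ h₁) := by
  obtain ⟨m, hm, hml⟩ := exists_pos_le_length hl
  refine continuous_of_lipschitz hl (K := K / m) fun e s s' => (hF e s s').trans ?_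
  rw [div_mul_eq_mul_div, le_div_iff₀ hm, mul_assoc]
  refine mul_le_mul_of_nonneg_left ?_ hK
  rw [mul_comm]
  exact mul_le_mul_of_nonneg_right (hml e) (abs_nonneg _)

open Classical in
/-- The tent function of a vertex `v`: it is `1` at `v`, falls linearly on the first third of each
edge starting at `v` and the last third of each edge ending at `v`, and vanishes elsewhere. -/
noncomputable def vertexTent (v : V) : Γ.Realization l → ℝ :=
  lift (fun e s => (if Γ.o e = v then max 0 (1 - 3 * (s : ℝ)) else 0) +
      (if Γ.t e = v then max 0 (3 * (s : ℝ) - 2) else 0))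
    (fun w => if w = v then 1 else 0) (by intro e; norm_num) (by intro e; norm_num)

theorem abs_max_zero_sub_le (a b : ℝ) : |max 0 a - max 0 b| ≤ |a - b| := by
  have := abs_max_sub_max_le_max 0 a 0 b
  simpa using this

theorem continuous_vertexTent [Finite E] (hl : ∀ e, 0 < l e) (v : V) :
    Continuous (vertexTent v : Γ.Realization l → ℝ) := by
  refine continuous_lift_of_lipschitz hl (K := 6) (by norm_num) fun e s s' => ?_
  have h1 := abs_max_zero_sub_le (1 - 3 * (s : ℝ)) (1 - 3 * s')
  have h2 := abs_max_zero_sub_le (3 * (s : ℝ) - 2) (3 * s' - 2)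
  have e1 : |(1 - 3 * (s : ℝ)) - (1 - 3 * s')| = 3 * |(s : ℝ) - s'| := by
    rw [show (1 - 3 * (s : ℝ)) - (1 - 3 * s') = (-3) * (s - s') by ring, abs_mul]; norm_num
  have e2 : |(3 * (s : ℝ) - 2) - (3 * s' - 2)| = 3 * |(s : ℝ) - s'| := by
    rw [show (3 * (s : ℝ) - 2) - (3 * s' - 2) = 3 * (s - s') by ring, abs_mul]; norm_num
  rw [e1] at h1
  rw [e2] at h2
  have h3 := abs_nonneg ((s : ℝ) - s')
  rw [add_sub_add_comm]
  refine (abs_add_le _ _).trans ?_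
  split_ifs <;> (try simp only [sub_self, abs_zero]) <;> linarith

theorem vertexTent_vert_self (v : V) : vertexTent v (vert v : Γ.Realization l) = 1 := by
  simp [vertexTent]

theorem vertexTent_vert_of_ne {v w : V} (h : w ≠ v) :
    vertexTent v (vert w : Γ.Realization l) = 0 := by
  simp [vertexTent, h]

/-- If `3ρ ≤ 1`, the tent function of `v` is greater than `1 - 3ρ` only at points that are
reached from `v` along one edge before the parameter `ρ`. -/
theorem of_lt_vertexTent_pt {v : V} {e : E} {s : I} {ρ : ℝ} (hρ : ρ ≤ 1 / 3)
    (h : 1 - 3 * ρ < vertexTent v (pt e s : Γ.Realization l)) :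
    (Γ.o e = v ∧ (s : ℝ) < ρ) ∨ (Γ.t e = v ∧ 1 - ρ < (s : ℝ)) := by
  simp only [vertexTent, lift_pt] at h
  have h0 := s.2.1
  have h1 := s.2.2
  rcases max_cases 0 (1 - 3 * (s : ℝ)) with ⟨a, a'⟩ | ⟨a, a'⟩ <;>
  rcases max_cases 0 (3 * (s : ℝ) - 2) with ⟨b, b'⟩ | ⟨b, b'⟩ <;>
  rw [a, b] at h <;> by_cases ho : Γ.o e = v <;> by_cases ht : Γ.t e = v <;>
    simp only [ho, ht, if_true, if_false, true_and, false_and, or_false, false_or] at h ⊢ <;>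
    first
      | linarith
      | exact Or.inl (by linarith)
      | exact Or.inr (by linarith)

open Classical in
/-- The tent function of height `ρ` at the point with parameter `s₀` on the edge `e₀`. -/
noncomputable def edgeTent (e₀ : E) (s₀ ρ : ℝ) (h₀ : ρ ≤ s₀) (h₁ : ρ ≤ 1 - s₀) :
    Γ.Realization l → ℝ :=
  lift (fun e s => if e = e₀ then max 0 (ρ - |(s : ℝ) - s₀|) else 0) (fun _ => 0)
    (by
      intro e
      have : ρ - |((0 : I) : ℝ) - s₀| ≤ 0 := by
        have := neg_abs_le (((0 : I) : ℝ) - s₀)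
        simp only [Set.Icc.coe_zero] at this ⊢
        linarith
      rw [max_eq_left this, ite_self])
    (by
      intro e
      have : ρ - |((1 : I) : ℝ) - s₀| ≤ 0 := by
        have := le_abs_self (((1 : I) : ℝ) - s₀)
        simp only [Set.Icc.coe_one] at this ⊢
        linarith
      rw [max_eq_left this, ite_self])

section edgeTent

variable {e₀ : E} {s₀ ρ : ℝ} {h₀ : ρ ≤ s₀} {h₁ : ρ ≤ 1 - s₀}

theorem continuous_edgeTent [Finite E] (hl : ∀ e, 0 < l e) :
    Continuous (edgeTent e₀ s₀ ρ h₀ h₁ : Γ.Realization l → ℝ) := by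
  refine continuous_lift_of_lipschitz hl (K := 1) (by norm_num) fun e s s' => ?_
  have h1 := abs_max_zero_sub_le (ρ - |(s : ℝ) - s₀|) (ρ - |(s' : ℝ) - s₀|)
  have h2 := abs_abs_sub_abs_le_abs_sub ((s' : ℝ) - s₀) ((s : ℝ) - s₀)
  rw [sub_sub_sub_cancel_left] at h1
  rw [sub_sub_sub_cancel_right, abs_sub_comm (s' : ℝ) s] at h2
  split_ifs
  · linarith
  · simp

theorem edgeTent_vert (v : V) : edgeTent e₀ s₀ ρ h₀ h₁ (vert v : Γ.Realization l) = 0 := rfl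

theorem edgeTent_pt_pos_iff {e : E} {s : I} :
    0 < edgeTent e₀ s₀ ρ h₀ h₁ (pt e s : Γ.Realization l) ↔ e = e₀ ∧ |(s : ℝ) - s₀| < ρ := by
  simp only [edgeTent, lift_pt]
  split_ifs with h <;> simp [h]

end edgeTent

/-- A point of an edge is either the image of a vertex or has a parameter different from both `0`
and `1`. -/
theorem pt_mem_range_vert_or (e : E) (s : I) :
    (∃ v, (pt e s : Γ.Realization l) = vert v) ∨ (s ≠ 0 ∧ s ≠ 1) := by
  by_cases h0 : s = 0
  · exact Or.inl ⟨_, h0 ▸ pt_zero e⟩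
  by_cases h1 : s = 1
  · exact Or.inl ⟨_, h1 ▸ pt_one e⟩
  exact Or.inr ⟨h0, h1⟩

/-- The realization of a finite graph is a Hausdorff space: the tent functions separate points. -/
theorem t2Space [Finite E] (hl : ∀ e, 0 < l e) : T2Space (Γ.Realization l) := by
  have sep : ∀ {x y : Γ.Realization l} (f : Γ.Realization l → ℝ), Continuous f → f x ≠ f y →
      ∃ u v : Set (Γ.Realization l), IsOpen u ∧ IsOpen v ∧ x ∈ u ∧ y ∈ v ∧ Disjoint u v :=
    fun f hf hne => separated_by_continuous hf hne
  have key : ∀ (e : E) (s : I), s ≠ 0 → s ≠ 1 → ∀ y : Γ.Realization l, pt e s ≠ y →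
      ∃ f : Γ.Realization l → ℝ, Continuous f ∧ f (pt e s) ≠ f y := by
    intro e s hs0 hs1 y hy
    have hs0' : 0 < (s : ℝ) := unitInterval.pos_iff_ne_zero.2 hs0
    have hs1' : (s : ℝ) < 1 := unitInterval.lt_one_iff_ne_one.2 hs1
    have main : ∃ ρ : ℝ, 0 < ρ ∧ ∃ (h₀ : ρ ≤ s) (h₁ : ρ ≤ 1 - s),
        ¬ 0 < edgeTent (Γ := Γ) (l := l) e s ρ h₀ h₁ y := by
      obtain ⟨v | ⟨e', s'⟩, rfl⟩ := Quot.exists_rep y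
      · exact ⟨min s (1 - s), by simp [hs0', hs1'], min_le_left _ _, min_le_right _ _,
          (edgeTent_vert v).le.not_gt⟩
      · by_cases hss : s' = s
        · refine ⟨min s (1 - s), by simp [hs0', hs1'], min_le_left _ _, min_le_right _ _, fun h => ?_⟩
          exact hy (by rw [← (edgeTent_pt_pos_iff.1 h).1, ← hss]; rfl)
        · have hss' : 0 < |(s' : ℝ) - s| := abs_pos.2 (sub_ne_zero.2 fun h => hss (Subtype.ext h))
          refine ⟨min (min s (1 - s)) |(s' : ℝ) - s|, lt_min (by simp [hs0', hs1']) hss',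
            (min_le_left _ _).trans (min_le_left _ _), (min_le_left _ _).trans (min_le_right _ _),
            fun h => ?_⟩
          exact absurd (edgeTent_pt_pos_iff.1 h).2 (min_le_right _ _).not_gt
    obtain ⟨ρ, hρ, h₀, h₁, hn⟩ := main
    refine ⟨edgeTent e s ρ h₀ h₁, continuous_edgeTent hl, fun h => hn ?_⟩
    rw [← h]
    exact edgeTent_pt_pos_iff.2 ⟨rfl, by simpa using hρ⟩
  have cases : ∀ x : Γ.Realization l, (∃ v, x = vert v) ∨ ∃ e s, s ≠ 0 ∧ s ≠ 1 ∧ x = pt e s := by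
    intro x
    obtain ⟨v | ⟨e, s⟩, rfl⟩ := Quot.exists_rep x
    · exact Or.inl ⟨v, rfl⟩
    · exact (pt_mem_range_vert_or e s).imp id fun h => ⟨e, s, h.1, h.2, rfl⟩
  refine ⟨fun x y hxy => ?_⟩
  rcases cases x with ⟨v, rfl⟩ | ⟨e, s, hs0, hs1, rfl⟩
  · rcases cases y with ⟨w, rfl⟩ | ⟨e, s, hs0, hs1, rfl⟩
    · refine sep _ (continuous_vertexTent hl v) ?_
      rw [vertexTent_vert_self, vertexTent_vert_of_ne fun h => hxy (congrArg vert h.symm)]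
      exact one_ne_zero
    · obtain ⟨f, hf, hne⟩ := key e s hs0 hs1 _ hxy.symm
      exact sep f hf hne.symm
  · obtain ⟨f, hf, hne⟩ := key e s hs0 hs1 _ hxy
    exact sep f hf hne

/-- A map out of the product of a compact space with the realization of a finite graph is
continuous if it is continuous on each edge. -/
theorem continuous_prod_of_edges [Finite E] (hl : ∀ e, 0 < l e) (ho : Function.Surjective Γ.o)
    {K Y : Type*} [TopologicalSpace K] [CompactSpace K] [T2Space K] [TopologicalSpace Y]
    {f : K × Γ.Realization l → Y}
    (hf : ∀ e, Continuous fun p : K × I => f (p.1, pt e p.2)) : Continuous f := by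
  have := t2Space (Γ := Γ) hl
  let : TopologicalSpace E := ⊥
  have : DiscreteTopology E := ⟨rfl⟩
  let π : E × (K × I) → K × Γ.Realization l := fun p => (p.2.1, pt p.1 p.2.2)
  have hπ : Continuous π := continuous_prod_of_discrete_left.2 fun e =>
    continuous_fst.prodMk ((continuous_pt e).comp continuous_snd)
  have hsurj : Function.Surjective π := by
    rintro ⟨k, x⟩
    obtain ⟨e, s, rfl⟩ := exists_pt_eq ho x
    exact ⟨(e, k, s), rfl⟩
  refine (hπ.isClosedMap.isQuotientMap hπ hsurj).continuous_iff.2 ?_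
  exact continuous_prod_of_discrete_left.2 hf

theorem continuous_of_edges [Finite E] (hl : ∀ e, 0 < l e) (ho : Function.Surjective Γ.o)
    {Y : Type*} [TopologicalSpace Y] {f : Γ.Realization l → Y}
    (hf : ∀ e, Continuous fun s => f (pt e s)) : Continuous f := by
  have h := continuous_prod_of_edges (K := Unit) hl ho (f := fun p => f p.2)
    fun e => (hf e).comp continuous_snd
  exact h.comp (continuous_const.prodMk continuous_id : Continuous fun x => ((), x))

end Basic

end Realization

end DirGraph

/-! ### Homotopy classes of paths and chains -/

theorem unitInterval.contractibleSpace : ContractibleSpace I :=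
  (convex_Icc (0 : ℝ) 1).contractibleSpace (Set.nonempty_Icc.2 zero_le_one)

theorem unitInterval.simplyConnectedSpace : SimplyConnectedSpace I :=
  have := unitInterval.contractibleSpace
  inferInstance

/-- The linear path between two points of the unit interval. -/
def unitInterval.linePath (s s' : I) : Path s s' where
  toFun t := ⟨(1 - t) * s + t * s', by
    have := (convex_Icc (0 : ℝ) 1) s.2 s'.2 (sub_nonneg.2 t.2.2) t.2.1 (by ring)
    simpa using this⟩
  continuous_toFun := by fun_prop
  source' := by simp
  target' := by simp

theorem unitInterval.coe_linePath (s s' t : I) :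
    (linePath s s' t : ℝ) = (1 - t) * s + t * s' := rfl

namespace Path.Homotopic.Quotient

variable {X Y : Type*} [TopologicalSpace X] [TopologicalSpace Y]

@[simp]
theorem trans_symm_cancel_left {x y z : X} (p : Path.Homotopic.Quotient x y)
    (q : Path.Homotopic.Quotient x z) : p.trans (p.symm.trans q) = q := by
  rw [← trans_assoc, trans_symm, refl_trans]

@[simp]
theorem symm_trans_cancel_left {x y z : X} (p : Path.Homotopic.Quotient y x)
    (q : Path.Homotopic.Quotient x z) : p.symm.trans (p.trans q) = q := by
  rw [← trans_assoc, symm_trans, refl_trans]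

@[simp]
theorem symm_symm {x y : X} (p : Path.Homotopic.Quotient x y) : p.symm.symm = p := by
  induction p with
  | mk p => simp only [← mk_symm, Path.symm_symm]

theorem symm_of_trans {x y z : X} (p : Path.Homotopic.Quotient x y)
    (q : Path.Homotopic.Quotient y z) : (p.trans q).symm = q.symm.trans p.symm := by
  induction p with
  | mk p =>
    induction q with
    | mk q => simp only [← mk_symm, ← mk_trans, Path.trans_symm]

@[simp]
theorem symm_refl (x : X) : (refl x).symm = refl x := by
  simp only [← mk_refl, ← mk_symm, Path.refl_symm]

theorem symm_cast {x y x' y' : X} (p : Path.Homotopic.Quotient x y) (hx : x' = x) (hy : y' = y) :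
    (p.cast hx hy).symm = p.symm.cast hy hx := by
  subst hx hy
  simp

theorem map_refl (f : C(X, Y)) (x : X) : (refl x).map f = refl (f x) := rfl

theorem map_trans (f : C(X, Y)) {x y z : X} (p : Path.Homotopic.Quotient x y)
    (q : Path.Homotopic.Quotient y z) : (p.trans q).map f = (p.map f).trans (q.map f) := by
  induction p with
  | mk p =>
    induction q with
    | mk q => simp only [← mk_map, ← mk_trans, Path.map_trans]

theorem map_symm (f : C(X, Y)) {x y : X} (p : Path.Homotopic.Quotient x y) :
    p.symm.map f = (p.map f).symm := by
  induction p with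
  | mk p => rfl

theorem eq_of_simplyConnectedSpace [SimplyConnectedSpace X] {x y : X}
    (p q : Path.Homotopic.Quotient x y) : p = q := by
  induction p with
  | mk p =>
    induction q with
    | mk q => exact Path.Homotopic.Quotient.eq.2 (SimplyConnectedSpace.paths_homotopic p q)

/-- The two ways around a square are homotopic. -/
theorem mk_trans_mk_of_square {a b c d : X} (F : C(I × I, X)) {p : Path a b} {q : Path b d}
    {p' : Path a c} {q' : Path c d} (hp : ∀ t, F (0, t) = p t) (hq : ∀ u, F (u, 1) = q u)
    (hp' : ∀ u, F (u, 0) = p' u) (hq' : ∀ t, F (1, t) = q' t) :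
    (mk p).trans (mk q) = (mk p').trans (mk q') := by
  have := unitInterval.contractibleSpace
  obtain rfl : a = F (0, 0) := by simp [hp]
  obtain rfl : b = F (0, 1) := by simp [hp]
  obtain rfl : c = F (1, 0) := by simp [hp']
  obtain rfl : d = F (1, 1) := by simp [hq]
  let P (u : I) : Path ((u, 0) : I × I) (u, 1) :=
    ⟨⟨fun t => (u, t), by fun_prop⟩, rfl, rfl⟩
  let Q (t : I) : Path ((0, t) : I × I) (1, t) :=
    ⟨⟨fun u => (u, t), by fun_prop⟩, rfl, rfl⟩
  have e1 : mk p = (mk (P 0)).map F := congrArg mk (Path.ext (funext fun t => (hp t).symm))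
  have e2 : mk q = (mk (Q 1)).map F := congrArg mk (Path.ext (funext fun t => (hq t).symm))
  have e3 : mk p' = (mk (Q 0)).map F := congrArg mk (Path.ext (funext fun t => (hp' t).symm))
  have e4 : mk q' = (mk (P 1)).map F := congrArg mk (Path.ext (funext fun t => (hq' t).symm))
  rw [e1, e2, e3, e4, ← map_trans, ← map_trans]
  exact congrArg (map · F) (eq_of_simplyConnectedSpace _ _)

end Path.Homotopic.Quotient

/-- The type of homotopy classes of paths from `x` to `y` relative to the end points. -/
abbrev PathClass {X : Type*} [TopologicalSpace X] (x y : X) : Type _ :=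
  Path.Homotopic.Quotient x y

namespace DirGraph

namespace Realization

section Chains

variable {V E : Type*} {Γ : DirGraph V E} {l : E → ℝ}

/-- The homotopy class of the segment of the edge `e` from the parameter `s` to the parameter
`s'`. -/
noncomputable def seg (e : E) (s s' : I) :
    PathClass (pt e s : Γ.Realization l) (pt e s') :=
  Path.Homotopic.Quotient.map (X := I) (x₀ := s) (x₁ := s')
    (Path.Homotopic.Quotient.mk (unitInterval.linePath s s'))
    ⟨pt e, continuous_pt e⟩

theorem seg_eq (e : E) {s s' : I} (p : PathClass s s') :
    (seg e s s' : PathClass (pt e s : Γ.Realization l) (pt e s')) =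
      p.map ⟨pt e, continuous_pt e⟩ := by
  have := unitInterval.simplyConnectedSpace
  exact congrArg (Path.Homotopic.Quotient.map · _) (Path.Homotopic.Quotient.eq_of_simplyConnectedSpace _ p)

/-- A path inside an edge is homotopic to a segment. -/
theorem mk_eq_seg {e : E} {s s' : I} (p : Path (pt e s : Γ.Realization l) (pt e s'))
    (q : Path s s') (h : ∀ t, p t = pt e (q t)) : Path.Homotopic.Quotient.mk p = seg e s s' := by
  rw [seg_eq e (Path.Homotopic.Quotient.mk q)]
  exact congrArg Path.Homotopic.Quotient.mk (Path.ext (funext h))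

@[simp]
theorem seg_self (e : E) (s : I) :
    (seg e s s : PathClass (pt e s : Γ.Realization l) (pt e s)) = Path.Homotopic.Quotient.refl _ :=
  seg_eq e (Path.Homotopic.Quotient.refl s)

theorem seg_symm (e : E) (s s' : I) :
    (seg e s s' : PathClass (pt e s : Γ.Realization l) (pt e s')).symm = seg e s' s := by
  unfold seg
  rw [← Path.Homotopic.Quotient.map_symm]
  exact (seg_eq e _).symm

theorem seg_trans (e : E) (s s' s'' : I) :
    (seg e s s' : PathClass (pt e s : Γ.Realization l) (pt e s')).trans (seg e s' s'') =
      seg e s s'' := by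
  unfold seg
  rw [← Path.Homotopic.Quotient.map_trans]
  exact (seg_eq e _).symm

/-- `ChainClass x y r g` holds if `g` is the homotopy class of a path of length `r` from `x` to `y`
that is a concatenation of finitely many segments, each of them inside one edge. -/
inductive ChainClass : (x y : Γ.Realization l) → ℝ → PathClass x y → Prop
  | nil (x : Γ.Realization l) : ChainClass x x 0 (Path.Homotopic.Quotient.refl x)
  | cons (e : E) (s s' : I) {y : Γ.Realization l} {r : ℝ} {g : PathClass (pt e s') y} :
      ChainClass (pt e s') y r g →
        ChainClass (pt e s) y (l e * |(s : ℝ) - s'| + r) ((seg e s s').trans g)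

namespace ChainClass

theorem of_chain {x y : Γ.Realization l} {r : ℝ} (h : Chain x y r) :
    ∃ g, ChainClass x y r g := by
  induction h with
  | nil x => exact ⟨_, nil x⟩
  | cons e s s' _ ih => exact ⟨_, cons e s s' ih.choose_spec⟩

theorem seg (e : E) (s s' : I) :
    ChainClass (Γ := Γ) (l := l) (pt e s) (pt e s') (l e * |(s : ℝ) - s'|) (seg e s s') := by
  simpa using cons e s s' (nil (Γ := Γ) (l := l) (pt e s'))

theorem trans {x y z : Γ.Realization l} {r r' : ℝ} {g : PathClass x y} {g' : PathClass y z}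
    (h : ChainClass x y r g) (h' : ChainClass y z r' g') :
    ChainClass x z (r + r') (g.trans g') := by
  induction h with
  | nil x => simpa using h'
  | cons e s s' _ ih =>
    rw [add_assoc, Path.Homotopic.Quotient.trans_assoc]
    exact cons e s s' (ih h')

theorem symm {x y : Γ.Realization l} {r : ℝ} {g : PathClass x y} (h : ChainClass x y r g) :
    ChainClass y x r g.symm := by
  induction h with
  | nil x => simpa using nil x
  | cons e s s' _ ih =>
    have h1 := ih.trans (ChainClass.seg e s' s)
    rwa [← seg_symm, ← Path.Homotopic.Quotient.symm_of_trans, abs_sub_comm, add_comm] at h1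

theorem cast {x y x' y' : Γ.Realization l} {r : ℝ} {g : PathClass x y} (h : ChainClass x y r g)
    (hx : x' = x) (hy : y' = y) : ChainClass x' y' r (g.cast hx hy) := by
  subst hx hy
  simpa using h

end ChainClass

/-- A family `ψ` of self-maps of the unit interval that fix the end points, one for each edge,
induces a self-map of the realization that is homotopic to the identity through a homotopy which
moves each point along its edge. Hence a path that is mapped to a single point `z` by this self-map
is homotopic to a path that first moves to `z` and then from `z` to the end point. -/
theorem seg_trans_mk_of_collapse [Finite E] (hl : ∀ e, 0 < l e) (ho : Function.Surjective Γ.o)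
    (ψ : E → C(I, I)) (h₀ : ∀ e, ψ e 0 = 0) (h₁ : ∀ e, ψ e 1 = 1) {z : Γ.Realization l}
    {a b : Γ.Realization l} (β : Path a b)
    (hβ : ∀ t e s, β t = pt e s → pt e (ψ e s) = z)
    {e e' : E} {s s' : I} (ha : a = pt e s) (hb : b = pt e' s')
    (hz : z = pt e (ψ e s)) (hz' : z = pt e' (ψ e' s')) :
    ((seg e (ψ e s) s).cast hz ha).trans (Path.Homotopic.Quotient.mk β) = (seg e' (ψ e' s') s').cast hz' hb := by
  let mix (u s r : I) : I := ⟨(1 - u) * s + u * r, by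
    have := (convex_Icc (0 : ℝ) 1) s.2 r.2 (sub_nonneg.2 u.2.2) u.2.1 (by ring)
    simpa using this⟩
  have hmix0 : ∀ s r, mix 0 s r = s := fun s r => Subtype.ext (by simp [mix])
  have hmix1 : ∀ s r, mix 1 s r = r := fun s r => Subtype.ext (by simp [mix])
  have hmixs : ∀ u s, mix u s s = s := fun u s => Subtype.ext (by simp [mix]; ring)
  have hmixc : Continuous fun p : I × I × I => mix p.1 p.2.1 p.2.2 := by
    simp only [mix]; fun_prop
  let H : I × Γ.Realization l → Γ.Realization l := fun p =>
    lift (fun e s => pt e (mix p.1 s (ψ e s))) vert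
      (fun e => by rw [h₀, hmixs, pt_zero]) (fun e => by rw [h₁, hmixs, pt_one]) p.2
  have hH : Continuous H := continuous_prod_of_edges hl ho fun e =>
    (continuous_pt e).comp (hmixc.comp (by fun_prop : Continuous fun p : I × I =>
      (p.1, p.2, ψ e p.2)))
  have track : ∀ (e : E) (s : I) (x : Γ.Realization l) (hx : x = pt e s) (hz : z = pt e (ψ e s))
      (q : Path x z), (∀ u, H (u, x) = q u) → Path.Homotopic.Quotient.mk q = (seg e s (ψ e s)).cast hx hz := by
    intro e s x hx hz q hq
    subst hx hz
    rw [Path.Homotopic.Quotient.cast_rfl_rfl]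
    exact mk_eq_seg q ⟨⟨fun u => mix u s (ψ e s), hmixc.comp
      (by fun_prop : Continuous fun u : I => (u, s, ψ e s))⟩, hmix0 _ _, hmix1 _ _⟩
      fun u => (hq u).symm
  have H0 : ∀ x, H (0, x) = x := fun x => by
    obtain ⟨e, s, rfl⟩ := exists_pt_eq ho x
    exact congrArg (pt e) (hmix0 _ _)
  have H1 : ∀ t, H (1, β t) = z := fun t => by
    obtain ⟨e, s, h⟩ := exists_pt_eq ho (β t)
    rw [h, ← hβ t e s h]
    exact congrArg (pt e) (hmix1 _ _)
  have hHu : ∀ x, Continuous fun u => H (u, x) := fun x =>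
    hH.comp (continuous_id.prodMk continuous_const)
  let qa : Path a z := ⟨⟨fun u => H (u, a), hHu a⟩, H0 a, by simpa using H1 0⟩
  let qb : Path b z := ⟨⟨fun u => H (u, b), hHu b⟩, H0 b, by simpa using H1 1⟩
  have key := Path.Homotopic.Quotient.mk_trans_mk_of_square ⟨fun p : I × I => H (p.1, β p.2), hH.comp (continuous_fst.prodMk (β.continuous.comp continuous_snd))⟩
    (p := β) (q := qb) (p' := qa) (q' := Path.refl z) (fun t => H0 _)
    (fun u => by simp [qb]) (fun u => by simp [qa]) (fun t => H1 t)
  rw [track e s a ha hz qa fun _ => rfl, track e' s' b hb hz' qb fun _ => rfl] at key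
  subst ha hb hz
  rw [Path.Homotopic.Quotient.mk_refl, Path.Homotopic.Quotient.trans_refl,
    Path.Homotopic.Quotient.cast_rfl_rfl] at key
  rw [Path.Homotopic.Quotient.cast_rfl_rfl, ← seg_symm, ← key,
    Path.Homotopic.Quotient.symm_of_trans, Path.Homotopic.Quotient.trans_assoc,
    Path.Homotopic.Quotient.symm_trans, Path.Homotopic.Quotient.trans_refl,
    Path.Homotopic.Quotient.symm_cast, seg_symm]

/-- Each point `z` has arbitrarily small neighbourhoods in which a path from `a` to `b` is, up to
homotopy, the difference of short chains from `z` to `a` and from `z` to `b`. -/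
theorem exists_nhds_shortChain [Finite E] (hl : ∀ e, 0 < l e) (ho : Function.Surjective Γ.o)
    (z : Γ.Realization l) {η : ℝ} (hη : 0 < η) :
    ∃ U : Set (Γ.Realization l), IsOpen U ∧ z ∈ U ∧ ∀ (a b : Γ.Realization l) (β : Path a b),
      (∀ t, β t ∈ U) → ∃ r < η, ∃ r' < η, ∃ (g : PathClass z a) (g' : PathClass z b),
        ChainClass z a r g ∧ ChainClass z b r' g' ∧
          g.trans (Path.Homotopic.Quotient.mk β) = g' := by
  -- It suffices to find a neighbourhood that is collapsed to `z` by moving points along their edges.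
  suffices h : ∃ (ψ : E → C(I, I)) (U : Set (Γ.Realization l)), (∀ e, ψ e 0 = 0) ∧
      (∀ e, ψ e 1 = 1) ∧ IsOpen U ∧ z ∈ U ∧ ∀ e s, pt e s ∈ U → pt e (ψ e s) = z ∧
        l e * |(ψ e s : ℝ) - s| < η by
    obtain ⟨ψ, U, h₀, h₁, hU, hz, h⟩ := h
    refine ⟨U, hU, hz, fun a b β hβ => ?_⟩
    obtain ⟨e, s, ha⟩ := exists_pt_eq ho a
    obtain ⟨e', s', hb⟩ := exists_pt_eq ho b
    have haU := h e s (by simpa [ha] using hβ 0)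
    have hbU := h e' s' (by simpa [hb] using hβ 1)
    exact ⟨_, haU.2, _, hbU.2, _, _, (ChainClass.seg e (ψ e s) s).cast haU.1.symm ha,
      (ChainClass.seg e' (ψ e' s') s').cast hbU.1.symm hb,
      seg_trans_mk_of_collapse hl ho ψ h₀ h₁ β (fun t e s ht => (h e s (ht ▸ hβ t)).1) ha hb _ _⟩
  obtain ⟨e₀, s₀, rfl⟩ := exists_pt_eq ho z
  rcases pt_mem_range_vert_or (Γ := Γ) (l := l) e₀ s₀ with ⟨v, hv⟩ | ⟨hs0, hs1⟩
  · obtain ⟨M, hM, hMl⟩ : ∃ M, 0 < M ∧ ∀ e, l e ≤ M := by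
      obtain ⟨M, hM⟩ := (Set.finite_range l).bddAbove
      exact ⟨max M 1, by positivity, fun e => (hM ⟨e, rfl⟩).trans (le_max_left _ _)⟩
    obtain ⟨ρ, hρ, hρ3, hρη⟩ : ∃ ρ : ℝ, 0 < ρ ∧ ρ ≤ 1 / 3 ∧ M * ρ ≤ η :=
      ⟨min (1 / 3) (η / M), lt_min (by norm_num) (by positivity), min_le_left _ _,
        (mul_le_mul_of_nonneg_left (min_le_right _ _) hM.le).trans_eq (by field_simp)⟩
    have hlt : ∀ e (x : ℝ), 0 ≤ x → x < ρ → l e * x < η := fun e x hx hxρ =>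
      (mul_le_mul_of_nonneg_right (hMl e) hx).trans_lt
        ((mul_lt_mul_of_pos_left hxρ hM).trans_le hρη)
    -- The first third of each edge is collapsed to its origin, the last third to its target.
    let ψ : C(I, I) := ⟨fun s => Set.projIcc 0 1 zero_le_one (3 * (s : ℝ) - 1), by fun_prop⟩
    have ψ0 : ∀ s : I, (s : ℝ) ≤ 1 / 3 → ψ s = 0 := fun s hs =>
      Set.projIcc_of_le_left zero_le_one (by linarith)
    have ψ1 : ∀ s : I, 2 / 3 ≤ (s : ℝ) → ψ s = 1 := fun s hs =>
      Set.projIcc_of_right_le zero_le_one (by linarith)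
    refine ⟨fun _ => ψ, {x | 1 - 3 * ρ < vertexTent v x}, fun _ => ψ0 0 (by norm_num),
      fun _ => ψ1 1 (by norm_num), isOpen_lt continuous_const (continuous_vertexTent hl v),
      by simp [hv, vertexTent_vert_self, hρ], fun e s hs => ?_⟩
    rw [hv]
    rcases of_lt_vertexTent_pt hρ3 hs with ⟨rfl, h⟩ | ⟨rfl, h⟩
    · rw [ψ0 s (by linarith)]
      refine ⟨pt_zero e, hlt e _ (abs_nonneg _) ?_⟩
      simpa [abs_of_nonneg s.2.1] using h
    · rw [ψ1 s (by linarith)]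
      refine ⟨pt_one e, hlt e _ (abs_nonneg _) ?_⟩
      rw [Set.Icc.coe_one, abs_of_nonneg (sub_nonneg.2 s.2.2)]
      linarith
  · have hs0' : 0 < (s₀ : ℝ) := unitInterval.pos_iff_ne_zero.2 hs0
    have hs1' : (s₀ : ℝ) < 1 := unitInterval.lt_one_iff_ne_one.2 hs1
    have hl0 := hl e₀
    obtain ⟨ρ, hρ, hρ0, hρ1, hρη⟩ :
        ∃ ρ : ℝ, 0 < ρ ∧ 2 * ρ ≤ s₀ ∧ 2 * ρ ≤ 1 - s₀ ∧ l e₀ * ρ ≤ η := by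
      refine ⟨min (min (s₀ / 2) ((1 - s₀) / 2)) (η / l e₀), ?_, ?_, ?_, ?_⟩
      · exact lt_min (lt_min (by linarith) (by linarith)) (by positivity)
      · linarith [(min_le_left (min ((s₀ : ℝ) / 2) ((1 - s₀) / 2)) (η / l e₀)).trans
          (min_le_left _ _)]
      · linarith [(min_le_left (min ((s₀ : ℝ) / 2) ((1 - s₀) / 2)) (η / l e₀)).trans
          (min_le_right _ _)]
      · exact (mul_le_mul_of_nonneg_left (min_le_right _ _) hl0.le).trans_eq (by field_simp)
    -- The edge of `z` is collapsed to `z` near `z`, with a cut-off function `χ`.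
    let χ : I → I := fun s => Set.projIcc 0 1 zero_le_one (2 - |(s : ℝ) - s₀| / ρ)
    have hχ : Continuous χ := by fun_prop
    have χ1 : ∀ s : I, |(s : ℝ) - s₀| < ρ → χ s = 1 := fun s hs =>
      Set.projIcc_of_right_le zero_le_one (by
        have := (div_lt_one hρ).2 hs
        linarith)
    have χ0 : ∀ s : I, 2 * ρ ≤ |(s : ℝ) - s₀| → χ s = 0 := fun s hs =>
      Set.projIcc_of_le_left zero_le_one (by
        have := (le_div_iff₀ hρ).2 hs
        linarith)
    let ψ : C(I, I) := ⟨fun s => ⟨(1 - χ s) * s + χ s * s₀, by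
        have := (convex_Icc (0 : ℝ) 1) s.2 s₀.2 (sub_nonneg.2 (χ s).2.2) (χ s).2.1 (by ring)
        simpa using this⟩, by fun_prop⟩
    have ψ_fix : ∀ s, χ s = 0 → ψ s = s := fun s hs => Subtype.ext (by simp [ψ, hs])
    have ψ_col : ∀ s, χ s = 1 → ψ s = s₀ := fun s hs => Subtype.ext (by simp [ψ, hs])
    have hρ0' : ρ ≤ s₀ := by linarith
    have hρ1' : ρ ≤ 1 - s₀ := by linarith
    refine ⟨fun _ => ψ, {x | 0 < edgeTent e₀ s₀ ρ hρ0' hρ1' x},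
      fun _ => ψ_fix 0 (χ0 0 ?_), fun _ => ψ_fix 1 (χ0 1 ?_),
      isOpen_lt continuous_const (continuous_edgeTent (h₀ := hρ0') (h₁ := hρ1') hl),
      edgeTent_pt_pos_iff.2 ⟨rfl, by simpa using hρ⟩, fun e s hs => ?_⟩
    · rw [Set.Icc.coe_zero, zero_sub, abs_neg, abs_of_pos hs0']
      exact hρ0
    · rw [Set.Icc.coe_one, abs_of_pos (by linarith)]
      exact hρ1
    · obtain ⟨rfl, h⟩ := edgeTent_pt_pos_iff.1 hs
      rw [ψ_col s (χ1 s h)]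
      refine ⟨rfl, ?_⟩
      rw [abs_sub_comm]
      exact (mul_lt_mul_of_pos_left h hl0).trans_le hρη

end Chains

end Realization

end DirGraph

/-! ### Loops in balls and closed walks -/

/-- A family of sets of loop classes, one at each point of `X`, that contains the constant loops and
is closed under composition and under conjugation by paths. -/
structure NormalLoops (X : Type*) [TopologicalSpace X] where
  /-- The loop classes at `x` that belong to the family. -/
  mem : ∀ {x : X}, PathClass x x → Prop
  refl : ∀ x : X, mem (Path.Homotopic.Quotient.refl x)
  trans : ∀ {x : X} {g h : PathClass x x}, mem g → mem h → mem (g.trans h)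
  symm : ∀ {x : X} {g : PathClass x x}, mem g → mem g.symm
  conj : ∀ {x y : X} (p : PathClass x y) {g : PathClass y y},
    mem g → mem (p.trans (g.trans p.symm))

namespace DirGraph

namespace Realization

variable {V E : Type*} {Γ : DirGraph V E} {l : E → ℝ}

/-- The parameter of the origin (`false`) or of the target (`true`) of an edge. -/
def endParam (b : Bool) : I := bif b then 1 else 0

theorem exists_pt_endParam_eq_vert (e : E) (b : Bool) :
    ∃ v, (pt e (endParam b) : Γ.Realization l) = vert v := by
  cases b
  · exact ⟨_, pt_zero e⟩
  · exact ⟨_, pt_one e⟩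

theorem exists_eq_endParam {e : E} {s : I} {v : V} (h : (pt e s : Γ.Realization l) = vert v) :
    ∃ a, s = endParam a := by
  rcases pt_eq_vert_iff.1 h with ⟨rfl, _⟩ | ⟨rfl, _⟩
  · exact ⟨false, rfl⟩
  · exact ⟨true, rfl⟩

theorem abs_endParam_sub (a : Bool) : |(endParam a : ℝ) - endParam (!a)| = 1 := by
  cases a <;> simp [endParam]

theorem abs_sub_endParam_add (s : I) (a : Bool) :
    |(s : ℝ) - endParam a| + |(endParam (!a) : ℝ) - s| = 1 := by
  have h0 := s.2.1
  have h1 := abs_of_nonneg (sub_nonneg.2 s.2.2)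
  cases a
  · simp [endParam, abs_of_nonneg h0, h1]
  · rw [abs_sub_comm]
    simp [endParam, abs_of_nonneg h0, h1]

/-- `WalkClass x y ds g` holds if `g` is the class of the path from `x` to `y` that runs through the
whole oriented edges in the list `ds`. The pair `(e, false)` stands for the edge `e` traversed from
its origin to its target, and `(e, true)` for the edge traversed backwards. -/
inductive WalkClass : (x y : Γ.Realization l) → List (E × Bool) → PathClass x y → Prop
  | nil (x : Γ.Realization l) : WalkClass x x [] (Path.Homotopic.Quotient.refl x)
  | cons (e : E) (b : Bool) {y : Γ.Realization l} {ds : List (E × Bool)}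
      {g : PathClass (pt e (endParam (!b))) y} :
      WalkClass (pt e (endParam (!b))) y ds g →
        WalkClass (pt e (endParam b)) y ((e, b) :: ds)
          ((seg e (endParam b) (endParam (!b))).trans g)

/-- The length of the path along a list of oriented edges. -/
def walkLength (l : E → ℝ) (ds : List (E × Bool)) : ℝ := (ds.map fun d => l d.1).sum

@[simp]
theorem walkLength_nil : walkLength l [] = 0 := rfl

@[simp]
theorem walkLength_cons (d : E × Bool) (ds : List (E × Bool)) :
    walkLength l (d :: ds) = l d.1 + walkLength l ds := by
  simp [walkLength]

theorem walkLength_append (ds ds' : List (E × Bool)) :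
    walkLength l (ds ++ ds') = walkLength l ds + walkLength l ds' := by
  simp [walkLength]

namespace WalkClass

theorem trans {x y z : Γ.Realization l} {ds ds' : List (E × Bool)} {g : PathClass x y}
    {g' : PathClass y z} (h : WalkClass x y ds g) (h' : WalkClass y z ds' g') :
    WalkClass x z (ds ++ ds') (g.trans g') := by
  induction h with
  | nil x => simpa using h'
  | cons e b _ ih =>
    rw [Path.Homotopic.Quotient.trans_assoc]
    exact cons e b (ih h')

theorem single (e : E) (b : Bool) :
    WalkClass (Γ := Γ) (l := l) (pt e (endParam b)) (pt e (endParam (!b))) [(e, b)]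
      (seg e (endParam b) (endParam (!b))) := by
  simpa using cons e b (nil (Γ := Γ) (l := l) (pt e (endParam (!b))))

theorem chainClass {x y : Γ.Realization l} {ds : List (E × Bool)} {g : PathClass x y}
    (h : WalkClass x y ds g) : ChainClass x y (walkLength l ds) g := by
  induction h with
  | nil x => exact ChainClass.nil x
  | cons e b _ ih =>
    have := ChainClass.cons e (endParam b) (endParam (!b)) ih
    rwa [abs_endParam_sub, mul_one] at this

end WalkClass

/-- The normal form, up to homotopy, of a chain from a point of the realization to the fixed point
with parameter `s₀` on the edge `e₀`: either a segment of the edge `e₀`, or a segment to an end point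
of an edge, followed by a walk to an end point of `e₀` and by a segment of `e₀`. The real number is
an upper bound for the length. -/
inductive ReducedChain (e₀ : E) (s₀ : I) :
    (x : Γ.Realization l) → ℝ → PathClass x (pt e₀ s₀) → Prop
  | direct (s : I) {r : ℝ} : l e₀ * |(s : ℝ) - s₀| ≤ r →
      ReducedChain e₀ s₀ (pt e₀ s) r (seg e₀ s s₀)
  | walk (e : E) (s : I) (a b : Bool) {ds : List (E × Bool)}
      {w : PathClass (pt e (endParam a)) (pt e₀ (endParam b))} {r : ℝ} :
      WalkClass (pt e (endParam a)) (pt e₀ (endParam b)) ds w →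
      l e * |(s : ℝ) - endParam a| + (walkLength l ds + l e₀ * |(endParam b : ℝ) - s₀|) ≤ r →
      ReducedChain e₀ s₀ (pt e s) r
        ((seg e s (endParam a)).trans (w.trans (seg e₀ (endParam b) s₀)))

namespace ReducedChain

variable {e₀ : E} {s₀ : I}

theorem of_vert {x : Γ.Realization l} {r : ℝ} {g : PathClass x (pt e₀ s₀)}
    (h : ReducedChain e₀ s₀ x r g) (hx : ∃ v, x = vert v) :
    ∃ (b : Bool) (ds : List (E × Bool)) (w : PathClass x (pt e₀ (endParam b))),
      WalkClass x (pt e₀ (endParam b)) ds w ∧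
        walkLength l ds + l e₀ * |(endParam b : ℝ) - s₀| ≤ r ∧
        g = w.trans (seg e₀ (endParam b) s₀) := by
  obtain ⟨v, hv⟩ := hx
  cases h with
  | direct s hr =>
    obtain ⟨a, rfl⟩ := exists_eq_endParam hv
    exact ⟨a, [], _, WalkClass.nil _, by simpa using hr, by simp⟩
  | walk e s a b hw hr =>
    obtain ⟨a', rfl⟩ := exists_eq_endParam hv
    by_cases haa : a' = a
    · subst haa
      exact ⟨b, _, _, hw, by simpa using hr, by simp⟩
    · obtain rfl : a = !a' := by cases a <;> cases a' <;> simp_all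
      rw [abs_endParam_sub, mul_one, ← add_assoc] at hr
      exact ⟨b, _, _, WalkClass.cons e a' hw, by simpa using hr, by simp⟩

theorem cons (hl : ∀ e, 0 < l e) {x : Γ.Realization l} {r : ℝ} {g : PathClass x (pt e₀ s₀)}
    (h : ReducedChain e₀ s₀ x r g) (e : E) (s s' : I) (hx : x = pt e s') :
    ReducedChain e₀ s₀ (pt e s) (l e * |(s : ℝ) - s'| + r)
      (((seg e s s').cast rfl hx).trans g) := by
  rcases pt_mem_range_vert_or (Γ := Γ) (l := l) e s' with ⟨v, hv⟩ | ⟨hs0, hs1⟩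
  · obtain ⟨b, ds, w, hw, hr, rfl⟩ := h.of_vert ⟨v, hx.trans hv⟩
    obtain ⟨a, rfl⟩ := exists_eq_endParam hv
    subst hx
    rw [Path.Homotopic.Quotient.cast_rfl_rfl]
    exact walk e s a b hw (by linarith)
  · have tri : ∀ t : ℝ, l e * |(s : ℝ) - t| ≤ l e * |(s : ℝ) - s'| + l e * |(s' : ℝ) - t| :=
      fun t => by
        rw [← mul_add]
        exact mul_le_mul_of_nonneg_left (abs_sub_le _ _ _) (hl e).le
    cases h with
    | direct s₁ hr =>
      obtain ⟨rfl, rfl⟩ := pt_eq_pt_of_interior hs0 hs1 hx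
      rw [Path.Homotopic.Quotient.cast_rfl_rfl, seg_trans]
      exact direct s (by linarith [tri s₀])
    | walk e₁ s₁ a b hw hr =>
      obtain ⟨rfl, rfl⟩ := pt_eq_pt_of_interior hs0 hs1 hx
      rw [Path.Homotopic.Quotient.cast_rfl_rfl, ← Path.Homotopic.Quotient.trans_assoc, seg_trans]
      exact walk e₁ s a b hw (by linarith [tri (endParam a)])

theorem of_chainClass (hl : ∀ e, 0 < l e) {x y : Γ.Realization l} {r : ℝ} {g : PathClass x y}
    (h : ChainClass x y r g) (hy : y = pt e₀ s₀) :
    ReducedChain e₀ s₀ x r (g.cast rfl hy.symm) := by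
  induction h with
  | nil x =>
    subst hy
    rw [Path.Homotopic.Quotient.cast_rfl_rfl, ← seg_self]
    exact direct s₀ (by simp)
  | cons e s s' _ ih =>
    have := cons hl (ih hy) e s s' rfl
    subst hy
    simpa using this

/-- If a family of loop classes contains all closed walks of bounded length, then it contains the
closed chains of the same length, at least at an interior point of an edge. -/
theorem mem_of_interior (P : NormalLoops (Γ.Realization l)) {r : ℝ}
    (hP : ∀ (x : Γ.Realization l) (ds : List (E × Bool)) (g : PathClass x x), (∃ v, x = vert v) →
      WalkClass x x ds g → walkLength l ds ≤ r → P.mem g)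
    (hs0 : s₀ ≠ 0) (hs1 : s₀ ≠ 1) {x : Γ.Realization l} {g : PathClass x (pt e₀ s₀)}
    (h : ReducedChain e₀ s₀ x r g) (hx : x = pt e₀ s₀) (hl : ∀ e, 0 < l e) :
    P.mem (g.cast hx.symm rfl) := by
  cases h with
  | direct s hr =>
    obtain ⟨-, rfl⟩ := pt_eq_pt_of_interior hs0 hs1 hx
    rw [Path.Homotopic.Quotient.cast_rfl_rfl, seg_self]
    exact P.refl _
  | walk e s a b hw hr =>
    obtain ⟨rfl, rfl⟩ := pt_eq_pt_of_interior hs0 hs1 hx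
    have hle := (hl e).le
    rw [Path.Homotopic.Quotient.cast_rfl_rfl]
    by_cases hab : b = a
    · subst hab
      rw [← seg_symm e s]
      refine P.conj _ (hP _ _ _ (exists_pt_endParam_eq_vert e b) hw ?_)
      have h1 := mul_nonneg hle (abs_nonneg ((s : ℝ) - endParam b))
      have h2 := mul_nonneg hle (abs_nonneg ((endParam b : ℝ) - s))
      linarith
    · obtain rfl : b = !a := by cases a <;> cases b <;> simp_all
      have hw' := hw.trans (WalkClass.single e (!a))
      rw [Bool.not_not] at hw'
      rw [← seg_trans e (endParam (!a)) (endParam a) s, ← Path.Homotopic.Quotient.trans_assoc _ _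
        (seg e (endParam a) s), ← seg_symm e s]
      refine P.conj _ (hP _ _ _ (exists_pt_endParam_eq_vert e a) hw' ?_)
      have h1 := congrArg (l e * ·) (abs_sub_endParam_add s a)
      simp only [mul_add, mul_one] at h1
      rw [walkLength_append, walkLength_cons, walkLength_nil]
      linarith

end ReducedChain

/-- A closed chain is constant up to homotopy, or freely homotopic to a closed walk that is not
longer; so a family of loop classes that contains all closed walks up to a given length contains the
closed chains up to that length. -/
theorem mem_of_closed_chainClass (hl : ∀ e, 0 < l e) (ho : Function.Surjective Γ.o)
    (P : NormalLoops (Γ.Realization l)) {r : ℝ}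
    (hP : ∀ (x : Γ.Realization l) (ds : List (E × Bool)) (g : PathClass x x), (∃ v, x = vert v) →
      WalkClass x x ds g → walkLength l ds ≤ r → P.mem g)
    {x : Γ.Realization l} {g : PathClass x x} (h : ChainClass x x r g) : P.mem g := by
  obtain ⟨e₀, s₀, rfl⟩ := exists_pt_eq ho x
  have hred := ReducedChain.of_chainClass hl h rfl
  rw [Path.Homotopic.Quotient.cast_rfl_rfl] at hred
  rcases pt_mem_range_vert_or (Γ := Γ) (l := l) e₀ s₀ with ⟨v, hv⟩ | ⟨hs0, hs1⟩
  · obtain ⟨b, ds, w, hw, hr, rfl⟩ := hred.of_vert ⟨v, hv⟩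
    obtain ⟨a, rfl⟩ := exists_eq_endParam hv
    by_cases hab : b = a
    · subst hab
      rw [seg_self, Path.Homotopic.Quotient.trans_refl]
      exact hP _ _ _ ⟨v, hv⟩ hw (by simpa using hr)
    · obtain rfl : a = !b := by cases a <;> cases b <;> simp_all
      refine hP _ _ _ ⟨v, hv⟩ (hw.trans (WalkClass.single e₀ b)) ?_
      rw [abs_endParam_sub, mul_one] at hr
      rw [walkLength_append, walkLength_cons, walkLength_nil, add_zero]
      exact hr
  · simpa using hred.mem_of_interior P hP hs0 hs1 rfl hl

/-- A family of loop classes that contains all closed walks of length less than `2ε` contains every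
loop inside an open ball of radius `ε`. -/
theorem mem_of_loop_in_ball [Finite E] (hl : ∀ e, 0 < l e) (ho : Function.Surjective Γ.o)
    (P : NormalLoops (Γ.Realization l)) {ε : ℝ}
    (hP : ∀ (x : Γ.Realization l) (ds : List (E × Bool)) (g : PathClass x x), (∃ v, x = vert v) →
      WalkClass x x ds g → walkLength l ds < 2 * ε → P.mem g)
    {y c : Γ.Realization l} (β : Path y y) (hβ : ∀ t, edist (β t) c < ENNReal.ofReal ε) :
    P.mem (Path.Homotopic.Quotient.mk β) := by
  -- A path class is good if it can be closed up by short chains from the centre.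
  let Good {x z : Γ.Realization l} (q : PathClass x z) : Prop :=
    ∀ (r r' : ℝ) (g : PathClass c x) (h : PathClass c z), r < ε → r' < ε → ChainClass c x r g →
      ChainClass c z r' h → P.mem (g.trans (q.trans h.symm))
  have hshort : ∀ t, ∃ r < ε, ∃ g, ChainClass c (β t) r g := fun t => by
    obtain ⟨r, hr, h⟩ := exists_chain_of_edist_lt ((edist_comm _ _).trans_lt (hβ t))
    exact ⟨r, hr, ChainClass.of_chain h⟩
  have hclosed : ∀ {x} {r r' : ℝ} {g h : PathClass c x}, r < ε → r' < ε → ChainClass c x r g →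
      ChainClass c x r' h → P.mem (g.trans h.symm) := fun hr hr' hg hh =>
    mem_of_closed_chainClass hl ho P
      (fun x ds g hx hw hle => hP x ds g hx hw (by linarith)) (hg.trans hh.symm)
  have hrefl : ∀ x : Γ.Realization l, Good (Path.Homotopic.Quotient.refl x) :=
    fun x r r' g h hr hr' hg hh => by
      rw [Path.Homotopic.Quotient.refl_trans]
      exact hclosed hr hr' hg hh
  have htrans : ∀ {x z : Γ.Realization l} (t : I) (q : PathClass x (β t)) (q' : PathClass (β t) z),
      Good q → Good q' → Good (q.trans q') := by
    intro x z t q q' hq hq' r r' g h hr hr' hg hh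
    obtain ⟨r₁, hr₁, k, hk⟩ := hshort t
    have := P.trans (hq r r₁ g k hr hr₁ hg hk) (hq' r₁ r' k h hr₁ hr' hk hh)
    simpa using this
  have hlocal : ∀ t : I, ∃ U : Set (Γ.Realization l), IsOpen U ∧ β t ∈ U ∧
      ∀ (a b : Γ.Realization l) (p : Path a b), (∀ u, p u ∈ U) →
        Good (Path.Homotopic.Quotient.mk p) := by
    intro t
    obtain ⟨r₀, hr₀, g₀, hg₀⟩ := hshort t
    obtain ⟨U, hU, htU, h⟩ := exists_nhds_shortChain hl ho (β t) (sub_pos.2 hr₀)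
    refine ⟨U, hU, htU, fun a b p hp r r' g h' hr hr' hg hh' => ?_⟩
    obtain ⟨r₁, hr₁, r₂, hr₂, k₁, k₂, hk₁, hk₂, hk⟩ := h a b p hp
    have m₁ := hclosed hr (by linarith) hg (hg₀.trans hk₁)
    have m₂ := hclosed (by linarith) hr' (hg₀.trans hk₂) hh'
    have := P.trans m₁ m₂
    rw [← hk] at this
    simpa [Path.Homotopic.Quotient.symm_of_trans] using this
  choose U hUo hUt hU using hlocal
  obtain ⟨t, ht0, htm, ⟨n, hn⟩, htU⟩ := exists_monotone_Icc_subset_open_cover_unitInterval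
    (c := fun i => β ⁻¹' U i) (fun i => (hUo i).preimage β.continuous)
    (fun s _ => Set.mem_iUnion.2 ⟨s, hUt s⟩)
  have hind : ∀ k, Good (Path.Homotopic.Quotient.mk (β.subpath (t 0) (t k))) := by
    intro k
    induction k with
    | zero =>
      rw [Path.subpath_self]
      exact hrefl _
    | succ k ih =>
      obtain ⟨i, hi⟩ := htU k
      have hstep : Good (Path.Homotopic.Quotient.mk (β.subpath (t k) (t (k + 1)))) := by
        refine hU i _ _ _ fun u => ?_
        have hu : β.subpath (t k) (t (k + 1)) u ∈ Set.range (β.subpath (t k) (t (k + 1))) := ⟨u, rfl⟩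
        rw [Path.range_subpath_of_le _ _ _ (htm k.le_succ)] at hu
        obtain ⟨s, hs, hsu⟩ := hu
        rw [← hsu]
        exact hi hs
      have := htrans (t k) _ _ ih hstep
      rw [← Path.Homotopic.Quotient.mk_trans] at this
      rwa [Path.Homotopic.Quotient.eq.2 ⟨Path.Homotopy.subpathTransSubpath β (t 0) (t k) (t (k + 1))⟩]
        at this
  have hfin : ∀ {x z : Γ.Realization l} (q : PathClass x z) (hx : y = x) (hz : y = z), Good q →
      P.mem (q.cast hx hz) := by
    intro x z q hx hz hq
    subst hx hz
    obtain ⟨r, hr, g, hg⟩ := hshort 0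
    have hg' := hg.cast rfl β.source.symm
    have := P.conj (g.cast rfl β.source.symm).symm (hq r r _ _ hr hr hg' hg')
    simpa using this
  have h := hind n
  rw [ht0, hn n le_rfl] at h
  have h' := hfin _ β.source.symm β.target.symm h
  rw [Path.subpath_zero_one, Path.Homotopic.Quotient.mk_cast,
    Path.Homotopic.Quotient.cast_cast, Path.Homotopic.Quotient.cast_rfl_rfl] at h'
  exact h'

end Realization

end DirGraph

/-! ### Families of loop classes given by balls -/

namespace NormalLoops

variable {X : Type*} [PseudoEMetricSpace X]

theorem conj_mem_closure_smallLoopClasses {δ : ℝ} {x y : X} (p : PathClass x y)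
    {g : FundamentalGroup X y} (hg : g ∈ Subgroup.closure (smallLoopClasses y δ)) :
    FundamentalGroup.fromPath (p.trans (g.toPath.trans p.symm)) ∈
      Subgroup.closure (smallLoopClasses x δ) := by
  induction hg using Subgroup.closure_induction with
  | mem g hg =>
    obtain ⟨z, α, β, hβ, rfl⟩ := hg
    obtain ⟨p, rfl⟩ := Path.Homotopic.Quotient.mk_surjective p
    refine Subgroup.subset_closure ⟨z, p.trans α, β, hβ, ?_⟩
    simp only [Path.trans_symm, Path.Homotopic.Quotient.mk_trans,
      Path.Homotopic.Quotient.mk_symm, Path.Homotopic.Quotient.trans_assoc]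
  | one =>
    have : p.trans ((Path.Homotopic.Quotient.refl y).trans p.symm) =
        Path.Homotopic.Quotient.refl x := by simp
    rw [FundamentalGroup.one_def, this]
    exact one_mem (Subgroup.closure (smallLoopClasses x δ))
  | mul g h _ _ hg hh =>
    have : p.trans ((Path.Homotopic.Quotient.trans h g).trans p.symm) =
        (p.trans (Path.Homotopic.Quotient.trans h p.symm)).trans
          (p.trans (Path.Homotopic.Quotient.trans g p.symm)) := by simp
    rw [FundamentalGroup.mul_def, this]
    exact mul_mem hg hh
  | inv g _ hg =>
    have : p.trans ((Path.Homotopic.Quotient.symm g).trans p.symm) =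
        (p.trans (Path.Homotopic.Quotient.trans g p.symm)).symm := by
      simp [Path.Homotopic.Quotient.symm_of_trans]
    rw [FundamentalGroup.inv_def, this]
    exact inv_mem hg

/-- The loop classes in the `δ`-th step of the filtration of the fundamental groups by loops in
`δ`-balls. -/
def ofBalls (X : Type*) [PseudoEMetricSpace X] (δ : ℝ) : NormalLoops X where
  mem {x} g := FundamentalGroup.fromPath g ∈ Subgroup.closure (smallLoopClasses x δ)
  refl x := one_mem (Subgroup.closure (smallLoopClasses x δ))
  trans hg hh := mul_mem hh hg
  symm hg := inv_mem hg
  conj p _ hg := conj_mem_closure_smallLoopClasses p hg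

/-- A family of loop classes that contains all loops in `δ`-balls contains the `δ`-th step of the
filtration. -/
theorem mem_of_mem_closure (P : NormalLoops X) {δ : ℝ}
    (h : ∀ (y c : X) (β : Path y y), (∀ s, edist (β s) c < ENNReal.ofReal δ) →
      P.mem (Path.Homotopic.Quotient.mk β))
    {x : X} {g : FundamentalGroup X x} (hg : g ∈ Subgroup.closure (smallLoopClasses x δ)) :
    P.mem (FundamentalGroup.toPath g) := by
  induction hg using Subgroup.closure_induction with
  | mem g hg =>
    obtain ⟨y, α, β, ⟨c, hc⟩, rfl⟩ := hg
    simpa using! P.conj (Path.Homotopic.Quotient.mk α) (h y c β hc)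
  | one => exact P.refl x
  | mul g h _ _ hg hh => exact P.trans hh hg
  | inv g _ hg => exact P.symm hg

end NormalLoops

namespace DirGraph

namespace Realization

variable {V E : Type*} {Γ : DirGraph V E} {l : E → ℝ}

/-! ### Short closed chains lie in small balls -/

theorem ChainClass.chain {x y : Γ.Realization l} {r : ℝ} {g : PathClass x y}
    (h : ChainClass x y r g) : Chain x y r := by
  induction h with
  | nil x => exact Chain.nil x
  | cons e s s' _ ih => exact Chain.cons e s s' ih

/-- The class of a chain of length `r` from `x` to `y` is represented by a path whose points have
distances to `x` and `y` of sum at most `r`. -/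
theorem ChainClass.exists_path (hl : ∀ e, 0 < l e) {x y : Γ.Realization l} {r : ℝ}
    {g : PathClass x y} (h : ChainClass x y r g) :
    ∃ p : Path x y, Path.Homotopic.Quotient.mk p = g ∧
      ∀ t, edist x (p t) + edist (p t) y ≤ ENNReal.ofReal r := by
  induction h with
  | nil x => exact ⟨Path.refl x, rfl, by simp⟩
  | @cons e s s' y r g hg ih =>
    obtain ⟨p, hp, hpt⟩ := ih
    have hle := (hl e).le
    have hr := hg.chain.nonneg hl
    rw [ENNReal.ofReal_add (by positivity) hr]
    let q : Path s s' := unitInterval.linePath s s'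
    refine ⟨(q.map (continuous_pt e)).trans p, ?_, fun t => ?_⟩
    · rw [Path.Homotopic.Quotient.mk_trans, hp]
      rfl
    · have ht : ((q.map (continuous_pt e)).trans p) t ∈
          Set.range ((q.map (continuous_pt e)).trans p) := ⟨t, rfl⟩
      rw [Path.trans_range] at ht
      rcases ht with ⟨u, hu⟩ | ⟨u, hu⟩ <;> rw [← hu]
      · have h1 : edist (pt e s : Γ.Realization l) (pt e (q u)) +
            edist (pt e (q u) : Γ.Realization l) (pt e s') ≤
            ENNReal.ofReal (l e * |(s : ℝ) - s'|) := by
          refine (add_le_add (edist_pt_le e _ _) (edist_pt_le e _ _)).trans_eq ?_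
          rw [← ENNReal.ofReal_add (by positivity) (by positivity), ← mul_add]
          have e1 : (s : ℝ) - q u = u * (s - s') := by rw [unitInterval.coe_linePath]; ring
          have e2 : (q u : ℝ) - s' = (1 - u) * (s - s') := by rw [unitInterval.coe_linePath]; ring
          rw [e1, e2, abs_mul, abs_mul, abs_of_nonneg u.2.1,
            abs_of_nonneg (sub_nonneg.2 u.2.2)]
          congr 2
          ring
        calc edist (pt e s) (pt e (q u)) + edist (pt e (q u)) y
            ≤ edist (pt e s) (pt e (q u)) + (edist (pt e (q u)) (pt e s') + edist (pt e s') y) :=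
              add_le_add le_rfl (edist_triangle _ _ _)
          _ ≤ _ := by
              rw [← add_assoc]
              exact add_le_add h1 hg.chain.edist_le
      · calc edist (pt e s) (p u) + edist (p u) y
            ≤ (edist (pt e s) (pt e s') + edist (pt e s') (p u)) + edist (p u) y :=
              add_le_add (edist_triangle _ _ _) le_rfl
          _ ≤ _ := by
              rw [add_assoc]
              exact add_le_add (edist_pt_le e s s') (hpt u)

/-- A closed chain of length less than `2δ` lies in the open ball of radius `δ` around its base
point. -/
theorem ChainClass.mem_ofBalls (hl : ∀ e, 0 < l e) {x : Γ.Realization l} {r δ : ℝ}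
    {g : PathClass x x} (h : ChainClass x x r g) (hr : r < 2 * δ) :
    (NormalLoops.ofBalls (Γ.Realization l) δ).mem g := by
  obtain ⟨p, rfl, hp⟩ := h.exists_path hl
  refine Subgroup.subset_closure ⟨x, Path.refl x, p, ⟨x, fun t => ?_⟩, ?_⟩
  · have hr0 := h.chain.nonneg hl
    have h1 := hp t
    rw [edist_comm x, ← two_mul] at h1
    have h2 : 2 * edist (p t) x < 2 * ENNReal.ofReal δ := by
      refine h1.trans_lt ?_
      rw [← ENNReal.ofReal_ofNat, ← ENNReal.ofReal_mul (by norm_num)]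
      exact (ENNReal.ofReal_lt_ofReal_iff (by linarith)).2 hr
    exact lt_of_mul_lt_mul_left' h2
  · simp

/-! ### Walks in the graph -/

/-- The initial vertex of an oriented edge. -/
def dartSrc (Γ : DirGraph V E) (d : E × Bool) : V := bif d.2 then Γ.t d.1 else Γ.o d.1

/-- The final vertex of an oriented edge. -/
def dartTgt (Γ : DirGraph V E) (d : E × Bool) : V := bif d.2 then Γ.o d.1 else Γ.t d.1

/-- `IsWalk Γ v ds w` holds if the oriented edges in the list `ds` are consecutive and lead from `v`
to `w`. -/
def IsWalk (Γ : DirGraph V E) : V → List (E × Bool) → V → Prop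
  | v, [], w => v = w
  | v, d :: ds, w => dartSrc Γ d = v ∧ IsWalk Γ (dartTgt Γ d) ds w

theorem isWalk_single {v w : V} {d : E × Bool} :
    IsWalk Γ v [d] w ↔ dartSrc Γ d = v ∧ dartTgt Γ d = w := Iff.rfl

theorem isWalk_cons {v w : V} {d : E × Bool} {ds : List (E × Bool)} :
    IsWalk Γ v (d :: ds) w ↔ ∃ u, IsWalk Γ v [d] u ∧ IsWalk Γ u ds w :=
  ⟨fun h => ⟨_, ⟨h.1, rfl⟩, h.2⟩, by rintro ⟨_, ⟨h, rfl⟩, h'⟩; exact ⟨h, h'⟩⟩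

theorem pt_endParam (e : E) (b : Bool) :
    (pt e (endParam b) : Γ.Realization l) = vert (dartSrc Γ (e, b)) := by
  cases b
  · exact pt_zero e
  · exact pt_one e

theorem pt_endParam_not (e : E) (b : Bool) :
    (pt e (endParam (!b)) : Γ.Realization l) = vert (dartTgt Γ (e, b)) := by
  cases b
  · exact pt_one e
  · exact pt_zero e

namespace WalkClass

theorem exists_isWalk {x y : Γ.Realization l} {ds : List (E × Bool)} {g : PathClass x y}
    (h : WalkClass x y ds g) {v : V} (hv : x = vert v) : ∃ w, y = vert w ∧ IsWalk Γ v ds w := by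
  induction h generalizing v with
  | nil x => exact ⟨v, hv, rfl⟩
  | cons e b _ ih =>
    obtain ⟨w, hw, hwalk⟩ := ih (pt_endParam_not e b)
    exact ⟨w, hw, vert_injective ((pt_endParam e b).symm.trans hv), hwalk⟩

theorem isWalk {v w : V} {ds : List (E × Bool)}
    {g : PathClass (vert v : Γ.Realization l) (vert w)} (h : WalkClass (vert v) (vert w) ds g) :
    IsWalk Γ v ds w := by
  obtain ⟨w', hw, hwalk⟩ := h.exists_isWalk rfl
  rwa [vert_injective hw]

theorem of_isWalk {v w : V} {ds : List (E × Bool)} (h : IsWalk Γ v ds w) :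
    ∃ g, WalkClass (vert v : Γ.Realization l) (vert w) ds g := by
  induction ds generalizing v with
  | nil =>
    obtain rfl : v = w := h
    exact ⟨_, nil _⟩
  | cons d ds ih =>
    obtain ⟨rfl, h⟩ := h
    have h' := ih h
    rw [← pt_endParam_not d.1 d.2] at h'
    obtain ⟨g, hg⟩ := h'
    rw [← pt_endParam d.1 d.2]
    exact ⟨_, cons d.1 d.2 hg⟩

theorem exists_split {x y : Γ.Realization l} {d : E × Bool} {ds : List (E × Bool)}
    {g : PathClass x y} (h : WalkClass x y (d :: ds) g) :
    ∃ (z : Γ.Realization l) (g₁ : PathClass x z) (g₂ : PathClass z y),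
      WalkClass x z [d] g₁ ∧ WalkClass z y ds g₂ ∧ g = g₁.trans g₂ := by
  cases h with
  | cons e b h => exact ⟨_, _, _, single e b, h, rfl⟩

end WalkClass

/-! ### Counting the passages of a loop through the edges -/

section Winding

variable [Finite E] (ω : E → ℤ)

/-- The map from the realization to the circle `ℝ / ℤ` that sends all vertices to `0` and runs
through the circle `ω e` times along the edge `e`. -/
noncomputable def toCircle (hl : ∀ e, 0 < l e) (ho : Function.Surjective Γ.o) (ω : E → ℤ) :
    C(Γ.Realization l, AddCircle (1 : ℝ)) where
  toFun := lift (fun e s => (((ω e : ℝ) * s : ℝ) : AddCircle (1 : ℝ))) (fun _ => 0) (by simp)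
    (by
      intro e
      rw [AddCircle.coe_eq_zero_iff]
      exact ⟨ω e, by simp⟩)
  continuous_toFun := continuous_of_edges hl ho fun e =>
    (AddCircle.continuous_mk' 1).comp (by fun_prop : Continuous fun s : I => (ω e : ℝ) * s)

variable (hl : ∀ e, 0 < l e) (ho : Function.Surjective Γ.o)

/-- `HasShift hl ho ω g k` holds if the image in the circle of a path in the class `g` lifts to paths
in `ℝ` whose end points differ by `k`. -/
def HasShift {x y : Γ.Realization l} (g : PathClass x y) (k : ℝ) : Prop :=
  ∀ u : ((↑) : ℝ → AddCircle (1 : ℝ)) ⁻¹' {toCircle hl ho ω x},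
    ((AddCircle.isCoveringMap_coe (1 : ℝ)).monodromy (g.map (toCircle hl ho ω)) u : ℝ) = u + k

variable {ω hl ho}

theorem HasShift.refl (x : Γ.Realization l) :
    HasShift ω hl ho (Path.Homotopic.Quotient.refl x) 0 := fun u => by
  rw [Path.Homotopic.Quotient.map_refl, IsCoveringMap.monodromy_refl, id, add_zero]

theorem HasShift.trans {x y z : Γ.Realization l} {g : PathClass x y} {h : PathClass y z} {k k' : ℝ}
    (hg : HasShift ω hl ho g k) (hh : HasShift ω hl ho h k') :
    HasShift ω hl ho (g.trans h) (k + k') := fun u => by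
  rw [Path.Homotopic.Quotient.map_trans, IsCoveringMap.monodromy_trans_apply, hh, hg, add_assoc]

theorem HasShift.unique {x y : Γ.Realization l} {g : PathClass x y} {k k' : ℝ}
    (h : HasShift ω hl ho g k) (h' : HasShift ω hl ho g k') : k = k' := by
  obtain ⟨u, hu⟩ := QuotientAddGroup.mk_surjective (toCircle hl ho ω x)
  exact add_left_cancel ((h ⟨u, hu⟩).symm.trans (h' ⟨u, hu⟩))

theorem hasShift_seg (e : E) (s s' : I) :
    HasShift ω hl ho (seg e s s') (ω e * ((s' : ℝ) - s)) := fun u => by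
  let q : Path s s' := unitInterval.linePath s s'
  have hu : ((u : ℝ) : AddCircle (1 : ℝ)) = ((ω e * s : ℝ) : AddCircle (1 : ℝ)) := u.2
  have hlift : ∀ r : I, ((u + ω e * ((r : ℝ) - s) : ℝ) : AddCircle (1 : ℝ)) =
      toCircle hl ho ω (pt e r) := fun r => by
    rw [AddCircle.coe_add, hu, ← AddCircle.coe_add]
    change _ = ((ω e * r : ℝ) : AddCircle (1 : ℝ))
    congr 1
    ring
  let v : ((↑) : ℝ → AddCircle (1 : ℝ)) ⁻¹' {toCircle hl ho ω (pt e s')} :=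
    ⟨u + ω e * ((s' : ℝ) - s), hlift s'⟩
  let γ : Path (u : ℝ) (v : ℝ) := ⟨⟨fun t => u + ω e * ((q t : ℝ) - s), by fun_prop⟩,
    by simp, by simp [v]⟩
  have := (AddCircle.isCoveringMap_coe (1 : ℝ)).monodromy_eq_of_map_eq (ex := u) (ey := v)
    (γ := (seg e s s').map (toCircle hl ho ω)) (Path.Homotopic.Quotient.mk γ)
    (congrArg Path.Homotopic.Quotient.mk (Path.ext (funext fun t => hlift (q t))))
  rw [this]

/-- The number of passages, counted with orientation and with multiplicities `ω`, along a list of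
oriented edges. -/
def walkCount (ω : E → ℤ) (ds : List (E × Bool)) : ℤ :=
  (ds.map fun d => bif d.2 then -ω d.1 else ω d.1).sum

theorem WalkClass.hasShift {x y : Γ.Realization l} {ds : List (E × Bool)} {g : PathClass x y}
    (h : WalkClass x y ds g) : HasShift ω hl ho g (walkCount ω ds) := by
  induction h with
  | nil x => simpa [walkCount] using HasShift.refl x
  | cons e b _ ih =>
    have := (hasShift_seg (hl := hl) (ho := ho) (ω := ω) e (endParam b) (endParam (!b))).trans ih
    convert this using 1
    cases b <;> simp [walkCount, endParam]

variable (ω hl ho) in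
/-- The loops whose total number of passages vanishes. -/
def unwound : NormalLoops (Γ.Realization l) where
  mem g := HasShift ω hl ho g 0
  refl x := HasShift.refl x
  trans hg hh := by simpa using hg.trans hh
  symm {x g} hg := fun u => by
    have h := (AddCircle.isCoveringMap_coe (1 : ℝ)).monodromy_trans_apply
      (g.map (toCircle hl ho ω)) (g.symm.map (toCircle hl ho ω)) u
    have h' := hg u
    rw [add_zero, Subtype.coe_inj] at h'
    rw [← Path.Homotopic.Quotient.map_trans, Path.Homotopic.Quotient.trans_symm,
      Path.Homotopic.Quotient.map_refl, IsCoveringMap.monodromy_refl, h'] at h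
    rw [← h, id, add_zero]
  conj {x y} p g hg := fun u => by
    have h := (AddCircle.isCoveringMap_coe (1 : ℝ)).monodromy_trans_apply
      (p.map (toCircle hl ho ω)) (p.symm.map (toCircle hl ho ω)) u
    have h' := hg ((AddCircle.isCoveringMap_coe (1 : ℝ)).monodromy (p.map (toCircle hl ho ω)) u)
    rw [add_zero, Subtype.coe_inj] at h'
    rw [← Path.Homotopic.Quotient.map_trans, Path.Homotopic.Quotient.trans_symm,
      Path.Homotopic.Quotient.map_refl, IsCoveringMap.monodromy_refl] at h
    rw [Path.Homotopic.Quotient.map_trans, Path.Homotopic.Quotient.map_trans,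
      IsCoveringMap.monodromy_trans_apply, IsCoveringMap.monodromy_trans_apply, h', ← h, id,
      add_zero]

end Winding

end Realization

end DirGraph

open DirGraph DirGraph.Realization

/-! ### The Schreier graphs of the Fano plane -/

section Graph

/-- The generators `A` (`false`) and `B` (`true`). -/
def fanoGen (κ : Bool) : GL3F2 := bif κ then fanoB else fanoA

theorem fanoB_ne_fanoA : fanoB ≠ fanoA := by decide

theorem exists_eq_fanoGen (s : ({fanoA, fanoB} : Set GL3F2)) : ∃ κ, (s : GL3F2) = fanoGen κ := by
  rcases s.2 with h | h
  · exact ⟨false, h⟩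
  · exact ⟨true, h⟩

theorem fanoGen_mem (κ : Bool) : fanoGen κ ∈ ({fanoA, fanoB} : Set GL3F2) := by
  cases κ
  · exact Or.inl rfl
  · exact Or.inr rfl

variable {V : Type} {lA lB : ℝ}

theorem fanoLength_of_eq {e : V × ({fanoA, fanoB} : Set GL3F2)} {κ : Bool}
    (h : (e.2 : GL3F2) = fanoGen κ) : fanoLength lA lB e = bif κ then lB else lA := by
  cases κ
  · exact if_pos h
  · refine if_neg ?_
    rw [h]
    exact fanoB_ne_fanoA

theorem fanoLength_pos (hA : 0 < lA) (hAB : lA < lB) (e : V × ({fanoA, fanoB} : Set GL3F2)) :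
    0 < fanoLength lA lB e := by
  obtain ⟨κ, h⟩ := exists_eq_fanoGen e.2
  rw [fanoLength_of_eq h]
  cases κ
  · exact hA
  · exact hA.trans hAB

theorem exists_label (d : (V × ({fanoA, fanoB} : Set GL3F2)) × Bool) :
    ∃ κ, (d.1.2 : GL3F2) = fanoGen κ := exists_eq_fanoGen d.1.2

/-- A walk that is shorter than both `4 l_A` and `l_A + 2 l_B` has at most three edges. If it has
three, then at most one of them has the label `B`. -/
theorem short_walk_cases (hA : 0 < lA) (hAB : lA < lB)
    {ds : List ((V × ({fanoA, fanoB} : Set GL3F2)) × Bool)}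
    (h4 : walkLength (fanoLength lA lB) ds < 4 * lA)
    (h3 : walkLength (fanoLength lA lB) ds < lA + 2 * lB) :
    ds = [] ∨ (∃ d, ds = [d]) ∨ (∃ d₁ d₂, ds = [d₁, d₂]) ∨
      ∃ d₁ d₂ d₃ κ₁ κ₂ κ₃, ds = [d₁, d₂, d₃] ∧ (d₁.1.2 : GL3F2) = fanoGen κ₁ ∧
        (d₂.1.2 : GL3F2) = fanoGen κ₂ ∧ (d₃.1.2 : GL3F2) = fanoGen κ₃ ∧
        ((κ₁ = false ∧ κ₂ = false ∧ κ₃ = false) ∨ (κ₁ = true ∧ κ₂ = false ∧ κ₃ = false) ∨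
          (κ₁ = false ∧ κ₂ = true ∧ κ₃ = false) ∨ (κ₁ = false ∧ κ₂ = false ∧ κ₃ = true)) := by
  have hge : ∀ d : (V × ({fanoA, fanoB} : Set GL3F2)) × Bool, lA ≤ fanoLength lA lB d.1 := by
    intro d
    obtain ⟨κ, h⟩ := exists_label d
    rw [fanoLength_of_eq h]
    cases κ
    · exact le_rfl
    · exact hAB.le
  match ds with
  | [] => exact Or.inl rfl
  | [d] => exact Or.inr (Or.inl ⟨d, rfl⟩)
  | [d₁, d₂] => exact Or.inr (Or.inr (Or.inl ⟨d₁, d₂, rfl⟩))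
  | [d₁, d₂, d₃] =>
    obtain ⟨κ₁, e₁⟩ := exists_label d₁
    obtain ⟨κ₂, e₂⟩ := exists_label d₂
    obtain ⟨κ₃, e₃⟩ := exists_label d₃
    refine Or.inr (Or.inr (Or.inr ⟨d₁, d₂, d₃, κ₁, κ₂, κ₃, rfl, e₁, e₂, e₃, ?_⟩))
    simp only [walkLength_cons, walkLength_nil, fanoLength_of_eq e₁, fanoLength_of_eq e₂,
      fanoLength_of_eq e₃] at h3
    cases κ₁ <;> cases κ₂ <;> cases κ₃ <;> simp at h3 ⊢ <;> linarith
  | d₁ :: d₂ :: d₃ :: d₄ :: ds =>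
    have hnn : 0 ≤ walkLength (fanoLength lA lB) ds :=
      List.sum_nonneg fun x hx => by
        obtain ⟨d, -, rfl⟩ := List.mem_map.1 hx
        exact hA.le.trans (hge d)
    simp only [walkLength_cons] at h4
    linarith [hge d₁, hge d₂, hge d₃, hge d₄]

variable [MulAction GL3F2ᵐᵒᵖ V]

variable (V) in
theorem cayleyGraph_o_surjective :
    Function.Surjective (cayleyGraph V ({fanoA, fanoB} : Set GL3F2)).o := fun v =>
  ⟨(v, ⟨fanoA, fanoGen_mem false⟩), rfl⟩

/-- The vertex that is reached from `v` along the edge with label `κ` in the direction `b`. -/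
def fanoNext (κ b : Bool) (v : V) : V :=
  (bif b then (MulOpposite.op (fanoGen κ))⁻¹ else MulOpposite.op (fanoGen κ)) • v

theorem eq_fanoNext_of_isWalk {v w : V} {d : (V × ({fanoA, fanoB} : Set GL3F2)) × Bool} {κ : Bool}
    (hκ : (d.1.2 : GL3F2) = fanoGen κ)
    (h : IsWalk (cayleyGraph V ({fanoA, fanoB} : Set GL3F2)) v [d] w) :
    w = fanoNext κ d.2 v ∧ d.1.1 = bif d.2 then w else v := by
  obtain ⟨⟨u, s⟩, b⟩ := d
  obtain ⟨rfl, rfl⟩ := isWalk_single.1 h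
  simp only at hκ
  cases b <;> simp [dartSrc, dartTgt, cayleyGraph, fanoNext, hκ]

end Graph

/-! ### The points of the Fano plane -/

section Points

variable {lA lB : ℝ}

/-- The point `(1, 1, 1)`. It is a vertex of the triangle with two edges `A` and one edge `B`. -/
def fanoApex : FanoPoint := ⟨![1, 1, 1], by decide⟩

/-- The point `(1, 1, 0)`, the origin of the edge with label `A` that ends at `(1, 1, 1)`. -/
def fanoBase : FanoPoint := ⟨![1, 1, 0], by decide⟩

open Classical in
/-- The cochain that counts the edge with label `A` starting at `(1, 1, 1)`. -/
noncomputable def apexEdge (e : FanoPoint × ({fanoA, fanoB} : Set GL3F2)) : ℤ :=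
  if e.1 = fanoApex ∧ (e.2 : GL3F2) = fanoA then 1 else 0

/-- The number of passages through the edge with label `A` at `(1, 1, 1)` when the edge with label
`κ` is traversed from the vertex `v` in the direction `b`. -/
def apexCount (κ b : Bool) (v : FanoPoint) : ℤ :=
  if κ = false ∧ (bif b then fanoNext κ b v else v) = fanoApex then bif b then -1 else 1 else 0

theorem walkCount_cons_apexEdge {v w : FanoPoint}
    {d : (FanoPoint × ({fanoA, fanoB} : Set GL3F2)) × Bool} {κ : Bool}
    (hκ : (d.1.2 : GL3F2) = fanoGen κ)
    (h : IsWalk (cayleyGraph FanoPoint ({fanoA, fanoB} : Set GL3F2)) v [d] w)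
    (ds : List ((FanoPoint × ({fanoA, fanoB} : Set GL3F2)) × Bool)) :
    walkCount apexEdge (d :: ds) = apexCount κ d.2 v + walkCount apexEdge ds := by
  obtain ⟨rfl, hd⟩ := eq_fanoNext_of_isWalk hκ h
  obtain ⟨⟨u, s⟩, b⟩ := d
  simp only at hκ hd
  have hA : fanoGen κ = fanoA ↔ κ = false := by
    cases κ
    · simp [fanoGen]
    · simp [fanoGen, fanoB_ne_fanoA]
  simp only [walkCount, List.map_cons, List.sum_cons, apexEdge, apexCount, hκ, hA, hd,
    and_comm (a := κ = false)]
  cases b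
  · rfl
  · simp only [cond_true]
    split_ifs <;> rfl

theorem apexCount_of_closed₁ : ∀ (v : FanoPoint) (κ b : Bool), fanoNext κ b v = v →
    apexCount κ b v = 0 := by
  decide +kernel

theorem apexCount_of_closed₂ : ∀ (v : FanoPoint) (κ b κ' b' : Bool),
    fanoNext κ' b' (fanoNext κ b v) = v →
      apexCount κ b v + apexCount κ' b' (fanoNext κ b v) = 0 := by
  decide +kernel

theorem apexCount_of_closed₃ : ∀ (v : FanoPoint) (b b' b'' : Bool),
    fanoNext false b'' (fanoNext false b' (fanoNext false b v)) = v →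
      apexCount false b v + (apexCount false b' (fanoNext false b v) +
        apexCount false b'' (fanoNext false b' (fanoNext false b v))) = 0 := by
  decide +kernel

/-- A closed walk in the graph of points that is shorter than the triangle does not pass through the
edge with label `A` at `(1, 1, 1)`, counted with orientation. -/
theorem walkCount_apexEdge_of_short (hA : 0 < lA) (hAB : lA < lB) (hB : lB < 3 / 2 * lA)
    {v : FanoPoint} {ds : List ((FanoPoint × ({fanoA, fanoB} : Set GL3F2)) × Bool)}
    (h : IsWalk (cayleyGraph FanoPoint ({fanoA, fanoB} : Set GL3F2)) v ds v)
    (hlen : walkLength (fanoLength lA lB) ds < 2 * lA + lB) : walkCount apexEdge ds = 0 := by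
  rcases short_walk_cases hA hAB (ds := ds) (by linarith) (by linarith) with
    rfl | ⟨d, rfl⟩ | ⟨d₁, d₂, rfl⟩ | ⟨d₁, d₂, d₃, κ₁, κ₂, κ₃, rfl, e₁, e₂, e₃, hκ⟩
  · rfl
  · obtain ⟨κ, e⟩ := exists_label d
    rw [walkCount_cons_apexEdge e h, apexCount_of_closed₁ v κ d.2 (eq_fanoNext_of_isWalk e h).1.symm]
    rfl
  · obtain ⟨κ₁, e₁⟩ := exists_label d₁
    obtain ⟨κ₂, e₂⟩ := exists_label d₂
    obtain ⟨v₁, h₁, h₂⟩ := isWalk_cons.1 h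
    rw [walkCount_cons_apexEdge e₁ h₁, walkCount_cons_apexEdge e₂ h₂]
    obtain rfl := (eq_fanoNext_of_isWalk e₁ h₁).1
    simpa [walkCount] using apexCount_of_closed₂ v κ₁ d₁.2 κ₂ d₂.2
      (eq_fanoNext_of_isWalk e₂ h₂).1.symm
  · simp only [walkLength_cons, walkLength_nil, fanoLength_of_eq e₁, fanoLength_of_eq e₂,
      fanoLength_of_eq e₃] at hlen
    obtain ⟨rfl, rfl, rfl⟩ : κ₁ = false ∧ κ₂ = false ∧ κ₃ = false := by
      rcases hκ with h | ⟨rfl, rfl, rfl⟩ | ⟨rfl, rfl, rfl⟩ | ⟨rfl, rfl, rfl⟩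
      · exact h
      all_goals
        simp only [cond_true, cond_false] at hlen
        linarith
    obtain ⟨v₁, h₁, h'⟩ := isWalk_cons.1 h
    obtain ⟨v₂, h₂, h₃⟩ := isWalk_cons.1 h'
    rw [walkCount_cons_apexEdge e₁ h₁, walkCount_cons_apexEdge e₂ h₂,
      walkCount_cons_apexEdge e₃ h₃]
    obtain rfl := (eq_fanoNext_of_isWalk e₁ h₁).1
    obtain rfl := (eq_fanoNext_of_isWalk e₂ h₂).1
    simpa [walkCount] using apexCount_of_closed₃ v d₁.2 d₂.2 d₃.2
      (eq_fanoNext_of_isWalk e₃ h₃).1.symm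

/-- The edges of the triangle with vertices `(1, 1, 0)`, `(1, 1, 1)` and `(1, 0, 1)`. -/
def fanoTriangle : List ((FanoPoint × ({fanoA, fanoB} : Set GL3F2)) × Bool) :=
  [((fanoBase, ⟨fanoGen false, fanoGen_mem false⟩), false),
    ((fanoApex, ⟨fanoGen false, fanoGen_mem false⟩), false),
    ((⟨![1, 0, 1], by decide⟩, ⟨fanoGen true, fanoGen_mem true⟩), false)]

theorem isWalk_fanoTriangle :
    IsWalk (cayleyGraph FanoPoint ({fanoA, fanoB} : Set GL3F2)) fanoBase fanoTriangle fanoBase := by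
  refine ⟨rfl, ?_, ?_, ?_⟩
  · change fanoApex = MulOpposite.op fanoA • fanoBase
    decide
  · change (⟨![1, 0, 1], _⟩ : FanoPoint) = MulOpposite.op fanoA • fanoApex
    decide
  · change MulOpposite.op fanoB • (⟨![1, 0, 1], _⟩ : FanoPoint) = fanoBase
    decide

theorem walkLength_fanoTriangle :
    walkLength (fanoLength lA lB) fanoTriangle = 2 * lA + lB := by
  simp only [fanoTriangle, walkLength_cons, walkLength_nil,
    fanoLength_of_eq (κ := false) (e := (_, ⟨fanoGen false, fanoGen_mem false⟩)) rfl,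
    fanoLength_of_eq (κ := true) (e := (_, ⟨fanoGen true, fanoGen_mem true⟩)) rfl, cond_true,
    cond_false]
  ring

theorem walkCount_fanoTriangle : walkCount apexEdge fanoTriangle = 1 := by
  have h1 : fanoBase ≠ fanoApex := by decide
  simp [fanoTriangle, walkCount, apexEdge, fanoGen, fanoB_ne_fanoA, h1]

theorem exists_word_to_fanoBase : ∀ v : FanoPoint,
    ∃ ks ∈ ([[], [false], [true, false], [true, true], [true, true, false], [false, true], [true]] :
      List (List Bool)), ks.foldl (fun v κ => MulOpposite.op (fanoGen κ) • v) v = fanoBase := by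
  decide +kernel

theorem exists_isWalk_to_fanoBase (v : FanoPoint) : ∃ ds,
    IsWalk (cayleyGraph FanoPoint ({fanoA, fanoB} : Set GL3F2)) v ds fanoBase := by
  obtain ⟨ks, -, h⟩ := exists_word_to_fanoBase v
  induction ks generalizing v with
  | nil => exact ⟨[], h⟩
  | cons κ ks ih =>
    obtain ⟨ds, hds⟩ := ih _ h
    exact ⟨((v, ⟨fanoGen κ, fanoGen_mem κ⟩), false) :: ds, rfl, hds⟩

theorem nonempty_pathClass_fanoBase (x : FanoSpace FanoPoint lA lB) :
    Nonempty (PathClass x (vert fanoBase)) := by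
  obtain ⟨e, s, rfl⟩ := exists_pt_eq (cayleyGraph_o_surjective FanoPoint) x
  obtain ⟨ds, hds⟩ := exists_isWalk_to_fanoBase
    ((cayleyGraph FanoPoint ({fanoA, fanoB} : Set GL3F2)).o e)
  obtain ⟨g, -⟩ := WalkClass.of_isWalk (l := fanoLength lA lB) hds
  exact ⟨(seg e s 0).trans (g.cast (pt_zero e) rfl)⟩

theorem mem_covSpec_fanoPoint (hA : 0 < lA) (hAB : lA < lB) (hB : lB < 3 / 2 * lA)
    (x : FanoSpace FanoPoint lA lB) :
    lA + 1 / 2 * lB ∈ covSpec (FanoSpace FanoPoint lA lB) x := by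
  have hl : ∀ e, 0 < fanoLength (V := FanoPoint) lA lB e := fanoLength_pos hA hAB
  have ho := cayleyGraph_o_surjective FanoPoint
  have hδ : 0 < lA + 1 / 2 * lB := by linarith
  refine ⟨⟨_, hδ⟩, fun ε hε heq => ?_, rfl⟩
  replace hε : lA + 1 / 2 * lB < (ε : ℝ) := hε
  obtain ⟨p⟩ := nonempty_pathClass_fanoBase x
  obtain ⟨g, hg⟩ := WalkClass.of_isWalk (l := fanoLength lA lB) isWalk_fanoTriangle
  have hmem : (NormalLoops.ofBalls (FanoSpace FanoPoint lA lB) ε).mem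
      (p.trans (g.trans p.symm)) := by
    refine NormalLoops.conj _ p (hg.chainClass.mem_ofBalls hl ?_)
    rw [walkLength_fanoTriangle]
    linarith
  have hmem' : FundamentalGroup.fromPath (p.trans (g.trans p.symm)) ∈
      ballFiltration x ⟨_, hδ⟩ := by
    rw [heq]
    exact hmem
  have hun : (unwound apexEdge hl ho).mem (p.trans (g.trans p.symm)) := by
    refine NormalLoops.mem_of_mem_closure _ (fun y c β hβ => ?_) hmem'
    refine mem_of_loop_in_ball hl ho _ (fun z ds h hz hw hlt => ?_) β hβ
    obtain ⟨v, rfl⟩ := hz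
    have h0 := walkCount_apexEdge_of_short hA hAB hB hw.isWalk (hlt.trans_eq (by ring))
    have hs := hw.hasShift (ω := apexEdge) (hl := hl) (ho := ho)
    rw [h0, Int.cast_zero] at hs
    exact hs
  have hg0 : (unwound apexEdge hl ho).mem g := by
    simpa using (unwound apexEdge hl ho).conj p.symm hun
  have h01 := HasShift.unique hg0 (hg.hasShift (ω := apexEdge) (hl := hl) (ho := ho))
  rw [walkCount_fanoTriangle] at h01
  simp at h01

end Points

/-! ### The lines of the Fano plane -/

section Lines

variable {lA lB : ℝ}

/-- The line of the points that are orthogonal to `w`. -/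
def fanoLine (w : FanoPoint) : FanoLine :=
  ⟨Finset.univ.filter fun p => p.1 ⬝ᵥ w.1 = 0, w.1, w.2, fun p => by simp⟩

theorem mem_fanoLine {w p : FanoPoint} : p ∈ (fanoLine w).1 ↔ p.1 ⬝ᵥ w.1 = 0 := by
  simp [fanoLine]

theorem exists_eq_fanoLine (L : FanoLine) : ∃ w, L = fanoLine w := by
  obtain ⟨L, w, hw, h⟩ := L
  exact ⟨⟨w, hw⟩, Subtype.ext (Finset.ext fun p => (h p).trans (mem_fanoLine (w := ⟨w, hw⟩)).symm)⟩

theorem eq_of_orthogonal_iff : ∀ (w : FanoPoint) (w' : Fin 3 → ZMod 2),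
    (∀ p : FanoPoint, p.1 ⬝ᵥ w.1 = 0 ↔ p.1 ⬝ᵥ w' = 0) → w.1 = w' := by
  decide +kernel

theorem mulVec_eq_of_smul_fanoLine {g : GL3F2} {w w' : FanoPoint}
    (h : MulOpposite.op g • fanoLine w = fanoLine w') : Matrix.mulVec g.val w'.1 = w.1 := by
  refine (eq_of_orthogonal_iff w _ fun p => ?_).symm
  rw [Matrix.dotProduct_mulVec, ← mem_fanoLine]
  have h1 : p ∈ (fanoLine w).1 ↔ MulOpposite.op g • p ∈ (MulOpposite.op g • fanoLine w).1 :=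
    (Finset.mem_image.trans ⟨by
      rintro ⟨q, hq, he⟩
      rwa [← smul_left_cancel _ he], fun hp => ⟨p, hp, rfl⟩⟩).symm
  rw [h1, h, mem_fanoLine]
  rfl

/-- The adjacency of two lines along an edge with label `κ`, in terms of orthogonal vectors. -/
def LineAdj (κ : Bool) (w w' : FanoPoint) : Prop :=
  Matrix.mulVec (fanoGen κ).val w'.1 = w.1 ∨ Matrix.mulVec (fanoGen κ).val w.1 = w'.1

instance (κ : Bool) (w w' : FanoPoint) : Decidable (LineAdj κ w w') :=
  inferInstanceAs (Decidable (_ ∨ _))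

theorem lineAdj_of_isWalk {w w' : FanoPoint}
    {d : (FanoLine × ({fanoA, fanoB} : Set GL3F2)) × Bool} {κ : Bool}
    (hκ : (d.1.2 : GL3F2) = fanoGen κ)
    (h : IsWalk (cayleyGraph FanoLine ({fanoA, fanoB} : Set GL3F2)) (fanoLine w) [d]
      (fanoLine w')) : LineAdj κ w w' := by
  have h1 := (eq_fanoNext_of_isWalk hκ h).1
  generalize d.2 = b at h1
  cases b
  · exact Or.inl (mulVec_eq_of_smul_fanoLine h1.symm)
  · exact Or.inr (mulVec_eq_of_smul_fanoLine (eq_inv_smul_iff.1 h1))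

set_option synthInstance.maxSize 1000 in
/-- In the graph of lines there is no triangle with two edges `A` and one edge `B`. -/
theorem eq_of_lineAdj : ∀ w₀ w₁ w₂ : FanoPoint, LineAdj false w₀ w₁ → LineAdj false w₁ w₂ →
    LineAdj true w₂ w₀ → w₀ = w₁ ∨ w₁ = w₂ ∨ w₂ = w₀ := by
  decide +kernel

/-- A closed walk in the graph of lines with two edges `A` and one edge `B` visits a vertex
twice. -/
theorem exists_eq_of_isWalk {v v₁ v₂ : FanoLine}
    {d₁ d₂ d₃ : (FanoLine × ({fanoA, fanoB} : Set GL3F2)) × Bool} {κ₁ κ₂ κ₃ : Bool}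
    (e₁ : (d₁.1.2 : GL3F2) = fanoGen κ₁) (e₂ : (d₂.1.2 : GL3F2) = fanoGen κ₂)
    (e₃ : (d₃.1.2 : GL3F2) = fanoGen κ₃)
    (h₁ : IsWalk (cayleyGraph FanoLine ({fanoA, fanoB} : Set GL3F2)) v [d₁] v₁)
    (h₂ : IsWalk (cayleyGraph FanoLine ({fanoA, fanoB} : Set GL3F2)) v₁ [d₂] v₂)
    (h₃ : IsWalk (cayleyGraph FanoLine ({fanoA, fanoB} : Set GL3F2)) v₂ [d₃] v)
    (hκ : (κ₁ = true ∧ κ₂ = false ∧ κ₃ = false) ∨ (κ₁ = false ∧ κ₂ = true ∧ κ₃ = false) ∨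
      (κ₁ = false ∧ κ₂ = false ∧ κ₃ = true)) :
    v = v₁ ∨ v₁ = v₂ ∨ v₂ = v := by
  obtain ⟨w, rfl⟩ := exists_eq_fanoLine v
  obtain ⟨w₁, rfl⟩ := exists_eq_fanoLine v₁
  obtain ⟨w₂, rfl⟩ := exists_eq_fanoLine v₂
  have a₁ := lineAdj_of_isWalk e₁ h₁
  have a₂ := lineAdj_of_isWalk e₂ h₂
  have a₃ := lineAdj_of_isWalk e₃ h₃
  rcases hκ with ⟨rfl, rfl, rfl⟩ | ⟨rfl, rfl, rfl⟩ | ⟨rfl, rfl, rfl⟩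
  · rcases eq_of_lineAdj _ _ _ a₂ a₃ a₁ with rfl | rfl | rfl <;> simp
  · rcases eq_of_lineAdj _ _ _ a₃ a₁ a₂ with rfl | rfl | rfl <;> simp
  · rcases eq_of_lineAdj _ _ _ a₁ a₂ a₃ with rfl | rfl | rfl <;> simp

/-- In the graph of lines, the closed walks whose length is only slightly greater than `2 l_A + l_B`
are products of loops in balls of radius `l_A + l_B / 2`. -/
theorem mem_ofBalls_of_walk_fanoLine (hA : 0 < lA) (hAB : lA < lB) (hB : lB < 3 / 2 * lA)
    {x : FanoSpace FanoLine lA lB}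
    {ds : List ((FanoLine × ({fanoA, fanoB} : Set GL3F2)) × Bool)} {g : PathClass x x}
    (hx : ∃ v, x = vert v) (hw : WalkClass x x ds g)
    (h4 : walkLength (fanoLength lA lB) ds < 4 * lA)
    (h3 : walkLength (fanoLength lA lB) ds < lA + 2 * lB) :
    (NormalLoops.ofBalls (FanoSpace FanoLine lA lB) (lA + 1 / 2 * lB)).mem g := by
  have hl : ∀ e, 0 < fanoLength (V := FanoLine) lA lB e := fanoLength_pos hA hAB
  have hshort : ∀ {y : FanoSpace FanoLine lA lB}
      {ds : List ((FanoLine × ({fanoA, fanoB} : Set GL3F2)) × Bool)} {g : PathClass y y},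
      WalkClass y y ds g → walkLength (fanoLength lA lB) ds < 2 * lA + lB →
      (NormalLoops.ofBalls (FanoSpace FanoLine lA lB) (lA + 1 / 2 * lB)).mem g :=
    fun h hlt => h.chainClass.mem_ofBalls hl (hlt.trans_eq (by ring))
  have hle : ∀ d : (FanoLine × ({fanoA, fanoB} : Set GL3F2)) × Bool,
      fanoLength lA lB d.1 ≤ lB := by
    intro d
    obtain ⟨κ, h⟩ := exists_label d
    rw [fanoLength_of_eq h]
    cases κ
    · exact hAB.le
    · exact le_rfl
  rcases short_walk_cases hA hAB h4 h3 with
    rfl | ⟨d, rfl⟩ | ⟨d₁, d₂, rfl⟩ | ⟨d₁, d₂, d₃, κ₁, κ₂, κ₃, rfl, e₁, e₂, e₃, hκ⟩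
  · exact hshort hw (by rw [walkLength_nil]; linarith)
  · refine hshort hw ?_
    rw [walkLength_cons, walkLength_nil]
    linarith [hle d]
  · refine hshort hw ?_
    rw [walkLength_cons, walkLength_cons, walkLength_nil]
    linarith [hle d₁, hle d₂]
  rcases hκ with ⟨rfl, rfl, rfl⟩ | hκ
  · refine hshort hw ?_
    simp only [walkLength_cons, walkLength_nil, fanoLength_of_eq e₁, fanoLength_of_eq e₂,
      fanoLength_of_eq e₃, cond_false]
    linarith
  have h₁ : ∀ d : (FanoLine × ({fanoA, fanoB} : Set GL3F2)) × Bool,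
      walkLength (fanoLength lA lB) [d] < 2 * lA + lB := fun d => by
    rw [walkLength_cons, walkLength_nil]
    linarith [hle d]
  have h₂ : ∀ d d' : (FanoLine × ({fanoA, fanoB} : Set GL3F2)) × Bool,
      walkLength (fanoLength lA lB) [d, d'] < 2 * lA + lB := fun d d' => by
    rw [walkLength_cons, walkLength_cons, walkLength_nil]
    linarith [hle d, hle d']
  obtain ⟨v, hv⟩ := hx
  obtain ⟨x₁, g₁, g', w₁, w', rfl⟩ := hw.exists_split
  obtain ⟨x₂, g₂, g₃, w₂, w₃, rfl⟩ := w'.exists_split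
  obtain ⟨v₁, hv₁, i₁⟩ := w₁.exists_isWalk hv
  obtain ⟨v₂, hv₂, i₂⟩ := w₂.exists_isWalk hv₁
  obtain ⟨v₃, hv₃, i₃⟩ := w₃.exists_isWalk hv₂
  obtain rfl : v₃ = v := vert_injective (hv₃.symm.trans hv)
  -- The walk is cut at the vertex that it visits twice.
  rcases exists_eq_of_isWalk e₁ e₂ e₃ i₁ i₂ i₃ hκ with h | h | h
  · obtain rfl : x = x₁ := by rw [hv, hv₁, h]
    exact NormalLoops.trans _ (hshort w₁ (h₁ _)) (hshort (w₂.trans w₃) (h₂ _ _))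
  · obtain rfl : x₁ = x₂ := by rw [hv₁, hv₂, h]
    have := NormalLoops.trans _ (NormalLoops.conj _ g₁ (hshort w₂ (h₁ _)))
      (hshort (w₁.trans w₃) (h₂ _ _))
    simpa using this
  · obtain rfl : x₂ = x := by rw [hv, hv₂, h]
    have := NormalLoops.trans _ (hshort (w₁.trans w₂) (h₂ _ _)) (hshort w₃ (h₁ _))
    simpa using this

theorem notMem_covSpec_fanoLine (hA : 0 < lA) (hAB : lA < lB) (hB : lB < 3 / 2 * lA)
    (x : FanoSpace FanoLine lA lB) :
    lA + 1 / 2 * lB ∉ covSpec (FanoSpace FanoLine lA lB) x := by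
  have hl : ∀ e, 0 < fanoLength (V := FanoLine) lA lB e := fanoLength_pos hA hAB
  have ho := cayleyGraph_o_surjective FanoLine
  rintro ⟨δ, hδ, hδ'⟩
  -- Below `2ε = min (4 l_A) (l_A + 2 l_B)` there are no closed walks longer than `2 l_A + l_B`.
  obtain ⟨ε, hlt, h4, h3⟩ : ∃ ε, lA + 1 / 2 * lB < ε ∧ 2 * ε ≤ 4 * lA ∧ 2 * ε ≤ lA + 2 * lB :=
    ⟨min (4 * lA) (lA + 2 * lB) / 2, by
      have : 2 * lA + lB < min (4 * lA) (lA + 2 * lB) := lt_min (by linarith) (by linarith)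
      linarith, by linarith [min_le_left (4 * lA) (lA + 2 * lB)],
      by linarith [min_le_right (4 * lA) (lA + 2 * lB)]⟩
  have hε : 0 < ε := by linarith
  have hδε : δ < ⟨ε, hε⟩ := Subtype.coe_lt_coe.1 (hδ'.trans_lt hlt)
  refine hδ ⟨ε, hε⟩ hδε (le_antisymm ((ballFiltration x).monotone hδε.le) fun g hg => ?_)
  have : (NormalLoops.ofBalls (FanoSpace FanoLine lA lB) (lA + 1 / 2 * lB)).mem
      (FundamentalGroup.toPath g) :=
    NormalLoops.mem_of_mem_closure _ (fun y c β hβ =>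
      mem_of_loop_in_ball hl ho _ (fun z ds h hz hw hlt' =>
        mem_ofBalls_of_walk_fanoLine hA hAB hB hz hw (hlt'.trans_le h4) (hlt'.trans_le h3)) β hβ) hg
  rw [← hδ'] at this
  exact this

end Lines

theorem mainTheorem2 (lA lB : ℝ) (hA : 0 < lA) (hAB : lA < lB) (hB : lB < 3 / 2 * lA) :
    (∀ x₁ : FanoSpace FanoPoint lA lB, lA + 1 / 2 * lB ∈ covSpec (FanoSpace FanoPoint lA lB) x₁) ∧
    (∀ x₂ : FanoSpace FanoLine lA lB, lA + 1 / 2 * lB ∉ covSpec (FanoSpace FanoLine lA lB) x₂) :=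
  ⟨mem_covSpec_fanoPoint hA hAB hB, notMem_covSpec_fanoLine hA hAB hB⟩
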